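/- Let $M$ be a simply connected smooth $4$-manifold with a hypercomplex structure, i.e. smooth endomorphism fields $J_1,J_2,J_3$ of $TM$ with $J_\alpha^2=-\mathrm{Id}$, $J_1J_2=-J_2J_1=J_3$ and vanishing Nijenhuis tensors $N_\alpha(X,Y)=[J_\alpha X,J_\alpha Y]-[X,Y]-J_\alpha([X,J_\alpha Y]+[J_\alpha X,Y])$, and let $g$ be a hyper-Hermitian metric on $M$, i.e. a smooth Riemannian metric with $g(J_\alpha X,J_\alpha Y)=g(X,Y)$ for $\alpha=1,2,3$. Put $\omega_\alpha(X,Y)=g(X,J_\alpha Y)$. Suppose that a (finite-dimensional, second countable) Lie group $G$ acts smoothly and simply transitively on $M$ by isometries of $g$ whose differentials commute with $J_1,J_2,J_3$. Then $g$ is conformal to a hyper-Kähler metric: there are a smooth function $f:M\to\mathbb{R}$ and a smooth Riemannian metric $h$ on $M$ with $g=e^{f}h$ such that $h$ is hyper-Hermitian with respect to $\{J_\alpha\}$ and its $2$-forms $h(\cdot,J_\alpha\cdot)$, $\alpha=1,2,3$, are closed. Moreover, the exact $1$-form $\theta=df$ satisfies $d\omega_\alpha=\theta\wedge\omega_\alpha$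 for $\alpha=1,2,3$. -/

import Mathlib

open scoped Manifold ContDiff
open Bundle

noncomputable section

namespace HyperHerm

section Forms

variable {E : Type*} [NormedAddCommGroup E] [NormedSpace ℝ E]
  (M : Type*) [TopologicalSpace M] [ChartedSpace E M]

/-- A (not necessarily smooth) vector field on the manifold `M`, modelled on `E`. -/
abbrev VField : Type _ := ∀ p : M, TangentSpace 𝓘(ℝ, E) p

/-- A (not necessarily smooth) field of bilinear forms on the tangent spaces of `M`. -/
abbrev TwoTensor : Type _ :=
  ∀ p : M, TangentSpace 𝓘(ℝ, E) p → TangentSpace 𝓘(ℝ, E) p → ℝ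

/-- A (not necessarily smooth) field of linear forms on the tangent spaces of `M`. -/
abbrev OneForm : Type _ := ∀ p : M, TangentSpace 𝓘(ℝ, E) p →L[ℝ] ℝ

variable {M}

/-- The vector field `X` is of class `C^∞`. -/
def SmoothVF [IsManifold 𝓘(ℝ, E) ∞ M] (X : VField (E := E) M) : Prop :=
  ContMDiff 𝓘(ℝ, E) 𝓘(ℝ, E).tangent ∞
    (fun p => (⟨p, X p⟩ : TangentBundle 𝓘(ℝ, E) M))

/-- The differential of a real function, as a 1-form. -/
def differential (f : M → ℝ) : OneForm (E := E) M :=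
  fun p => (mfderiv 𝓘(ℝ, E) 𝓘(ℝ, ℝ) f p : TangentSpace 𝓘(ℝ, E) p →L[ℝ] ℝ)

/-- The derivative `X f` of a function along a vector field. -/
def lieD (X : VField (E := E) M) (f : M → ℝ) : M → ℝ :=
  fun p => differential (E := E) f p (X p)

/-- The Lie bracket `[X, Y]` of vector fields. -/
def bracket (X Y : VField (E := E) M) : VField (E := E) M :=
  VectorField.mlieBracket 𝓘(ℝ, E) X Y

/-- The exterior derivative of a 2-form `σ`, evaluated on three vector fields:
`dσ(X,Y,Z) = X σ(Y,Z) - Y σ(X,Z) + Z σ(X,Y) - σ([X,Y],Z) + σ([X,Z],Y) - σ([Y,Z],X)`. -/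
def dTwo (σ : TwoTensor (E := E) M) (X Y Z : VField (E := E) M) (p : M) : ℝ :=
  lieD X (fun q => σ q (Y q) (Z q)) p
    - lieD Y (fun q => σ q (X q) (Z q)) p
    + lieD Z (fun q => σ q (X q) (Y q)) p
    - σ p (bracket X Y p) (Z p)
    + σ p (bracket X Z p) (Y p)
    - σ p (bracket Y Z p) (X p)

/-- The wedge product `θ ∧ σ` of a 1-form and a 2-form, evaluated on three tangent vectors. -/
def wedge (θ : OneForm (E := E) M) (σ : TwoTensor (E := E) M) (p : M)
    (u v w : TangentSpace 𝓘(ℝ, E) p) : ℝ :=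
  θ p u * σ p v w - θ p v * σ p u w + θ p w * σ p u v

end Forms

section Structures

variable (E : Type*) [NormedAddCommGroup E] [NormedSpace ℝ E]
  (M : Type*) [TopologicalSpace M] [ChartedSpace E M] [IsManifold 𝓘(ℝ, E) ∞ M]

/-- A hypercomplex structure: three smooth fields of endomorphisms `J 0`, `J 1`, `J 2` of the
tangent bundle satisfying the quaternion relations, with vanishing Nijenhuis tensors. -/
structure Hypercomplex where
  /-- the endomorphisms of the tangent spaces -/
  J : Fin 3 → ∀ p : M, TangentSpace 𝓘(ℝ, E) p →L[ℝ] TangentSpace 𝓘(ℝ, E) p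
  smooth : ∀ α, ContMDiff 𝓘(ℝ, E) (𝓘(ℝ, E).prod 𝓘(ℝ, E →L[ℝ] E)) ∞
    (fun p => TotalSpace.mk' (E →L[ℝ] E)
      (E := fun q : M => TangentSpace 𝓘(ℝ, E) q →L[ℝ] TangentSpace 𝓘(ℝ, E) q) p (J α p))
  sq : ∀ α p v, J α p (J α p v) = -v
  mul : ∀ p v, J 0 p (J 1 p v) = J 2 p v
  anti : ∀ p v, J 1 p (J 0 p v) = -J 2 p v
  nijenhuis : ∀ (α : Fin 3) (X Y : VField (E := E) M), SmoothVF X → SmoothVF Y → ∀ p,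
    bracket (fun q => J α q (X q)) (fun q => J α q (Y q)) p - bracket X Y p
      - J α p (bracket X (fun q => J α q (Y q)) p + bracket (fun q => J α q (X q)) Y p) = 0

/-- A smooth Riemannian metric on `M`. -/
abbrev Metric : Type _ :=
  ContMDiffRiemannianMetric 𝓘(ℝ, E) ∞ E (fun p : M => TangentSpace 𝓘(ℝ, E) p)

variable {E M}

/-- The metric `g` is hyper-Hermitian: every `J α` is orthogonal for `g`. -/
def IsHyperHermitian (H : Hypercomplex E M) (g : Metric E M) : Prop :=
  ∀ (α : Fin 3) (p : M) (v w : TangentSpace 𝓘(ℝ, E) p),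
    g.inner p (H.J α p v) (H.J α p w) = g.inner p v w

/-- The fundamental forms `ω_α(X, Y) = g(X, J_α Y)`. -/
def fundForm (H : Hypercomplex E M) (g : Metric E M) (α : Fin 3) : TwoTensor (E := E) M :=
  fun p v w => g.inner p v (H.J α p w)

/-- The metric `g` is hyper-Kähler: it is hyper-Hermitian and `dω_α = 0` for all `α`. -/
def IsHyperKahler (H : Hypercomplex E M) (g : Metric E M) : Prop :=
  IsHyperHermitian H g ∧
    ∀ (α : Fin 3) (X Y Z : VField (E := E) M), SmoothVF X → SmoothVF Y → SmoothVF Z →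
      ∀ p, dTwo (fundForm H g α) X Y Z p = 0

/-- `dω_α = θ ∧ ω_α` for all `α`. -/
def HasLeeForm (H : Hypercomplex E M) (g : Metric E M) (θ : OneForm (E := E) M) : Prop :=
  ∀ (α : Fin 3) (X Y Z : VField (E := E) M), SmoothVF X → SmoothVF Y → SmoothVF Z →
    ∀ p, dTwo (fundForm H g α) X Y Z p = wedge θ (fundForm H g α) p (X p) (Y p) (Z p)

/-- The diffeomorphism `φ` is an isometry of `g`. -/
def IsIsometric (g : Metric E M) (φ : M ≃ₘ^∞⟮𝓘(ℝ, E), 𝓘(ℝ, E)⟯ M) : Prop :=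
  ∀ (p : M) (v w : TangentSpace 𝓘(ℝ, E) p),
    g.inner (φ p) (mfderiv 𝓘(ℝ, E) 𝓘(ℝ, E) φ p v) (mfderiv 𝓘(ℝ, E) 𝓘(ℝ, E) φ p w)
      = g.inner p v w

/-- The diffeomorphism `φ` is hypercomplex: its differential commutes with every `J α`. -/
def IsHypercomplexMap (H : Hypercomplex E M) (φ : M ≃ₘ^∞⟮𝓘(ℝ, E), 𝓘(ℝ, E)⟯ M) : Prop :=
  ∀ (α : Fin 3) (p : M) (v : TangentSpace 𝓘(ℝ, E) p),
    mfderiv 𝓘(ℝ, E) 𝓘(ℝ, E) φ p (H.J α p v)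
      = H.J α (φ p) (mfderiv 𝓘(ℝ, E) 𝓘(ℝ, E) φ p v)

/-- The group action of `G` on `M` is simply transitive. -/
def IsSimplyTransitive (G : Type*) (M : Type*) [Group G] [MulAction G M] : Prop :=
  ∀ p q : M, ∃! a : G, a • p = q

end Structures

end HyperHerm

end

/-!
A simply transitive group of symmetries provides a global frame in which the metric, the complex
structures and all brackets are constant (`translate`). For its smoothness one needs that the orbit
map `G → M` is a diffeomorphism (`exists_contMDiff_orbit_section`): it is open by a Baire category
argument, its differentials are injective because a kernel vector would generate a one-parameter
group fixing a point, and openness makes the dimensions agree.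

This reduces the theorem to a 4-dimensional real Lie algebra with a compatible quaternionic
structure and inner product, identified with `ℍ` with the complex structures acting by left
multiplication. Integrability means that the bracket is `[x, y] = y * A x - x * A y` for a linear
map `A` (`exists_eq_obata`), where `∇_x y = y * A x` is the Obata connection. From `∇ g = θ ⊗ g`
with `θ = -2 Re A` one gets `dω_α = θ ∧ ω_α` for all three `α` (`lee_obata`).

The main point is that `θ` is closed (`closed_obata`). Let `τ x = tr (ad x)`. The trace of the
Jacobi identity says `τ ([x, y]) = 0`; evaluated on self-dual bivectors, it says that both `dθ` and
`τ ∧ θ` are anti-self-dual. The form `τ ∧ θ` is moreover decomposable, so `0 = (τ ∧ θ) ∧ (τ ∧ θ) =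
-|τ ∧ θ|²` up to a positive factor, and `τ ∧ θ = 0`. Now `d` of a 3-form is its product with `τ` up
to sign, so that `dθ ∧ dθ = d (θ ∧ dθ) = ± τ ∧ θ ∧ dθ = 0` (`d_wedge`), and `dθ = 0` because it is
anti-self-dual.

As `M` is simply connected, `θ = df` (`exists_primitive`: a global section of the covering space of
local primitives), and `h = e^{-f} g` satisfies `d (e^{-f} ω_α) = e^{-f} (dω_α - df ∧ ω_α) = 0`
(`isHyperKahler_conformal`).
-/

noncomputable section

namespace HyperHerm

/-! ### Integrable brackets on the quaternions -/

/-- The structure constants of the quaternions in the basis `1, i, j, k`, as integers: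
`e i * e j = ∑ k, quatInt i j k • e k`. -/
def quatInt : Fin 4 → Fin 4 → Fin 4 → ℤ :=
  ![![![1, 0, 0, 0], ![0, 1, 0, 0], ![0, 0, 1, 0], ![0, 0, 0, 1]],
    ![![0, 1, 0, 0], ![-1, 0, 0, 0], ![0, 0, 0, 1], ![0, 0, -1, 0]],
    ![![0, 0, 1, 0], ![0, 0, 0, -1], ![-1, 0, 0, 0], ![0, 1, 0, 0]],
    ![![0, 0, 0, 1], ![0, 0, 1, 0], ![0, -1, 0, 0], ![-1, 0, 0, 0]]]

/-- The structure constants of the quaternions, as real numbers. -/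
def quat (i j k : Fin 4) : ℝ := quatInt i j k

/-- The components of the bracket `[x, y] = y * A x - x * A y` on the quaternions, where
`A (e i) = ∑ m, a i m • e m`. -/
def obata (a : Fin 4 → Fin 4 → ℝ) (i j k : Fin 4) : ℝ :=
  ∑ m, (quat j m k * a i m - quat i m k * a j m)

/-- A bracket on `ℍ` for which the left multiplications by `i`, `j`, `k` have vanishing Nijenhuis
tensors is of the form `[x, y] = y * A x - x * A y`. Equivalently, there is a torsion-free invariant
connection `∇_x y = y * A x` commuting with the left multiplications (the Obata connection). -/
theorem exists_eq_obata (c : Fin 4 → Fin 4 → Fin 4 → ℝ) (anti : ∀ i j k, c i j k = -c j i k)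
    (nij : ∀ (α : Fin 3) (i j m : Fin 4),
      ∑ p, ∑ q, quat α.succ i p * quat α.succ j q * c p q m - c i j m
        - ∑ r, (∑ q, quat α.succ j q * c i q r + ∑ p, quat α.succ i p * c p j r)
            * quat α.succ r m = 0) :
    ∃ a : Fin 4 → Fin 4 → ℝ, ∀ i j k, c i j k = obata a i j k := by
  have s (i k) : c i i k = 0 := by linarith [anti i i k]
  have n10 := nij 0 0 2 0
  have n11 := nij 0 0 2 1
  have n12 := nij 0 0 2 2
  have n13 := nij 0 0 2 3
  have n20 := nij 1 0 1 0
  have n21 := nij 1 0 1 1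
  have n22 := nij 1 0 1 2
  have n23 := nij 1 0 1 3
  clear nij
  simp [quat, quatInt, Fin.sum_univ_four] at n10 n11 n12 n13 n20 n21 n22 n23
  have a21 := anti 2 1
  obtain ⟨a, lt⟩ : ∃ a : Fin 4 → Fin 4 → ℝ, ∀ i j k, i < j → c i j k = obata a i j k := by
    -- `a ↦ obata a` is injective from 16 parameters to the 24-dimensional space of alternating
    -- brackets, and the eight equations above cut out its image: `a` solves a linear system
    refine ⟨![![(c 0 1 1 + c 0 2 2 - c 1 2 3) / 2, (-c 0 1 0 - c 0 2 3 - c 1 2 2) / 2,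
          (c 0 1 3 - c 0 2 0 + c 1 2 1) / 2, (-c 0 1 2 + c 0 2 1 + c 1 2 0) / 2],
        ![(-c 0 1 0 + c 0 2 3 + c 1 2 2) / 2, (-c 0 1 1 + c 0 2 2 - c 1 2 3) / 2,
          (-c 0 1 2 - c 0 2 1 - c 1 2 0) / 2, (-c 0 1 3 - c 0 2 0 + c 1 2 1) / 2],
        ![(-c 0 1 3 - c 0 2 0 - c 1 2 1) / 2, (-c 0 1 2 - c 0 2 1 + c 1 2 0) / 2,
          (c 0 1 1 - c 0 2 2 - c 1 2 3) / 2, (c 0 1 0 - c 0 2 3 + c 1 2 2) / 2],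
        ![(c 0 1 2 - c 0 2 1 - 2 * c 0 3 0 - c 1 2 0) / 2,
          (-c 0 1 3 + c 0 2 0 - 2 * c 0 3 1 - c 1 2 1) / 2,
          (-c 0 1 0 - c 0 2 3 - 2 * c 0 3 2 - c 1 2 2) / 2,
          (c 0 1 1 + c 0 2 2 - 2 * c 0 3 3 - c 1 2 3) / 2]], ?_⟩
    intro i j k hij
    fin_cases i <;> fin_cases j <;> first | exact absurd hij (by decide) | skip
    all_goals
      fin_cases k <;> simp [obata, quat, quatInt, Fin.sum_univ_four] <;>
      linarith [a21 0, a21 1, a21 2, a21 3]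
  refine ⟨a, fun i j k => ?_⟩
  rcases lt_trichotomy i j with h | rfl | h
  · exact lt i j k h
  · rw [s]; simp [obata]
  · rw [anti, lt j i k h]; simp [obata]

/-- The form `⟨x * e l, e_α * y⟩` is symmetric in `x` and `y` for imaginary `e l`, and alternating
for `e l = 1`. -/
theorem quat_pairing (α : Fin 3) (j k l : Fin 4) :
    ∑ m, quat j l m * quat α.succ k m - ∑ m, quat k l m * quat α.succ j m
      = if l = 0 then 2 * quat α.succ k j else 0 := by
  have h : ∀ (α : Fin 3) (j k l : Fin 4),
      ∑ m, quatInt j l m * quatInt α.succ k m - ∑ m, quatInt k l m * quatInt α.succ j m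
        = if l = 0 then 2 * quatInt α.succ k j else 0 := by decide
  simp only [quat]
  exact_mod_cast h α j k l

/-- The Lee form of the standard metric on `ℍ` with the bracket `obata a` is `x ↦ -2 Re (A x)`: the
Obata connection `∇_x y = y * A x` satisfies `∇_x g = -2 Re (A x) g`, it preserves the complex
structures, and it has no torsion, so that `dω` is the alternation of `∇ω`. -/
theorem lee_obata (a : Fin 4 → Fin 4 → ℝ) (α : Fin 3) (i j k : Fin 4) :
    - ∑ m, obata a i j m * quat α.succ k m + ∑ m, obata a i k m * quat α.succ j m
      - ∑ m, obata a j k m * quat α.succ i m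
    = (-2 * a i 0) * quat α.succ k j - (-2 * a j 0) * quat α.succ k i
      + (-2 * a k 0) * quat α.succ j i := by
  have h0 (j k : Fin 4) := (quat_pairing α j k 0).trans (if_pos rfl)
  have h1 (j k : Fin 4) := (quat_pairing α j k 1).trans (if_neg (by decide))
  have h2 (j k : Fin 4) := (quat_pairing α j k 2).trans (if_neg (by decide))
  have h3 (j k : Fin 4) := (quat_pairing α j k 3).trans (if_neg (by decide))
  simp only [obata, Fin.sum_univ_four] at h0 h1 h2 h3 ⊢
  linear_combination (-a i 0) * h0 j k - a i 1 * h1 j k - a i 2 * h2 j k - a i 3 * h3 j k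
    + a j 0 * h0 i k + a j 1 * h1 i k + a j 2 * h2 i k + a j 3 * h3 i k
    - a k 0 * h0 i j - a k 1 * h1 i j - a k 2 * h2 i j - a k 3 * h3 i j

/-- On a 4-dimensional Lie algebra with `τ x = tr (ad x)` one has `dt ∧ dt = d (t ∧ dt)`, and `d` of
a 3-form is its wedge product with `τ` up to sign. In terms of `D = t ∘ [·,·]`, which is `-dt`, and
`P = τ ∧ t` this reads `D ∧ D = P ∧ D`. -/
theorem d_wedge (c : Fin 4 → Fin 4 → Fin 4 → ℝ) (anti : ∀ i j k, c i j k = -c j i k)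
    (jac : ∀ i j k m, ∑ l, (c j k l * c i l m + c k i l * c j l m + c i j l * c k l m) = 0)
    (t τ : Fin 4 → ℝ) (hτ : ∀ i, τ i = ∑ k, c i k k)
    (D P : Fin 4 → Fin 4 → ℝ) (hD : ∀ i j, D i j = ∑ k, c i j k * t k)
    (hP : ∀ i j, P i j = τ i * t j - τ j * t i) :
    2 * (D 0 1 * D 2 3 - D 0 2 * D 1 3 + D 0 3 * D 1 2)
      = P 0 1 * D 2 3 - P 0 2 * D 1 3 + P 0 3 * D 1 2
        + P 2 3 * D 0 1 - P 1 3 * D 0 2 + P 1 2 * D 0 3 := by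
  have s (i k) : c i i k = 0 := by linarith [anti i i k]
  have h012 := jac 0 1 2
  have h013 := jac 0 1 3
  have h023 := jac 0 2 3
  have h123 := jac 1 2 3
  simp only [hP, hτ, hD, Fin.sum_univ_four, s, anti 1 0, anti 2 0, anti 3 0, anti 2 1, anti 3 1,
    anti 3 2] at h012 h013 h023 h123 ⊢
  -- the Jacobi identity enters through `d (dt) = 0`, wedged with `t`
  linear_combination t 3 * (t 0 * h012 0 + t 1 * h012 1 + t 2 * h012 2 + t 3 * h012 3)
    - t 2 * (t 0 * h013 0 + t 1 * h013 1 + t 2 * h013 2 + t 3 * h013 3)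
    + t 1 * (t 0 * h023 0 + t 1 * h023 1 + t 2 * h023 2 + t 3 * h023 3)
    - t 0 * (t 0 * h123 0 + t 1 * h123 1 + t 2 * h123 2 + t 3 * h123 3)

/-- The form `D = t ∘ [·,·]`, where `t x = -2 Re (A x)`, is anti-self-dual. On a self-dual
bivector it agrees with `-τ ∘ [·,·]`, where `τ x = tr (ad x)`, and `τ` vanishes on brackets. -/
theorem asd_d_obata (a : Fin 4 → Fin 4 → ℝ)
    (jac : ∀ i j k m, ∑ l, (obata a j k l * obata a i l m + obata a k i l * obata a j l m
      + obata a i j l * obata a k l m) = 0)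
    (D : Fin 4 → Fin 4 → ℝ) (hD : ∀ i j, D i j = ∑ k, obata a i j k * (-2 * a k 0)) :
    D 2 3 = -D 0 1 ∧ D 1 3 = D 0 2 ∧ D 1 2 = -D 0 3 := by
  -- the three combinations are the traces over `m` of the Jacobi expression of `(u, v, e m)`, where
  -- `u ∧ v` runs over the self-dual bivectors `e 0 ∧ e 1 + e 2 ∧ e 3`, `e 1 ∧ e 3 - e 0 ∧ e 2` and
  -- `e 0 ∧ e 3 + e 1 ∧ e 2`
  refine ⟨?_, ?_, ?_⟩
  · have h1 := jac 0 1 2 2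
    have h2 := jac 0 1 3 3
    have h3 := jac 0 2 3 0
    have h4 := jac 1 2 3 1
    simp [hD, obata, quat, quatInt, Fin.sum_univ_four] at h1 h2 h3 h4 ⊢
    linear_combination h1 + h2 + h3 + h4
  · have h1 := jac 0 1 2 1
    have h2 := jac 0 1 3 0
    have h3 := jac 0 2 3 3
    have h4 := jac 1 2 3 2
    simp [hD, obata, quat, quatInt, Fin.sum_univ_four] at h1 h2 h3 h4 ⊢
    linear_combination h1 + h2 - h3 - h4
  · have h1 := jac 0 1 2 0
    have h2 := jac 0 1 3 1
    have h3 := jac 0 2 3 2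
    have h4 := jac 1 2 3 3
    simp [hD, obata, quat, quatInt, Fin.sum_univ_four] at h1 h2 h3 h4 ⊢
    linear_combination h1 - h2 - h3 + h4

/-- The form `P = τ ∧ t`, where `τ x = tr (ad x)` and `t x = -2 Re (A x)`, is anti-self-dual,
because it agrees with `-τ ∘ [·,·]` on self-dual bivectors. -/
theorem asd_p_obata (a : Fin 4 → Fin 4 → ℝ)
    (jac : ∀ i j k m, ∑ l, (obata a j k l * obata a i l m + obata a k i l * obata a j l m
      + obata a i j l * obata a k l m) = 0)
    (τ : Fin 4 → ℝ) (hτ : ∀ i, τ i = ∑ k, obata a i k k) (P : Fin 4 → Fin 4 → ℝ)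
    (hP : ∀ i j, P i j = τ i * (-2 * a j 0) - τ j * (-2 * a i 0)) :
    P 2 3 = -P 0 1 ∧ P 1 3 = P 0 2 ∧ P 1 2 = -P 0 3 := by
  refine ⟨?_, ?_, ?_⟩
  · have h1 := jac 0 1 2 2
    have h2 := jac 0 1 3 3
    have h3 := jac 0 2 3 0
    have h4 := jac 1 2 3 1
    simp [hP, hτ, obata, quat, quatInt, Fin.sum_univ_four] at h1 h2 h3 h4 ⊢
    linear_combination h1 + h2 + h3 + h4
  · have h1 := jac 0 1 2 1
    have h2 := jac 0 1 3 0
    have h3 := jac 0 2 3 3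
    have h4 := jac 1 2 3 2
    simp [hP, hτ, obata, quat, quatInt, Fin.sum_univ_four] at h1 h2 h3 h4 ⊢
    linear_combination h1 + h2 - h3 - h4
  · have h1 := jac 0 1 2 0
    have h2 := jac 0 1 3 1
    have h3 := jac 0 2 3 2
    have h4 := jac 1 2 3 3
    simp [hP, hτ, obata, quat, quatInt, Fin.sum_univ_four] at h1 h2 h3 h4 ⊢
    linear_combination h1 - h2 - h3 + h4

/-- The Lee form `t x = -2 Re (A x)` is closed, that is, it vanishes on brackets. -/
theorem closed_obata (a : Fin 4 → Fin 4 → ℝ)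
    (jac : ∀ i j k m, ∑ l, (obata a j k l * obata a i l m + obata a k i l * obata a j l m
      + obata a i j l * obata a k l m) = 0) (i j : Fin 4) :
    ∑ k, obata a i j k * (-2 * a k 0) = 0 := by
  have anti : ∀ i j k, obata a i j k = -obata a j i k := fun i j k => by simp [obata]
  obtain ⟨D, hD⟩ : ∃ D : Fin 4 → Fin 4 → ℝ, ∀ i j, D i j = ∑ k, obata a i j k * (-2 * a k 0) :=
    ⟨_, fun _ _ => rfl⟩
  obtain ⟨τ, hτ⟩ : ∃ τ : Fin 4 → ℝ, ∀ i, τ i = ∑ k, obata a i k k := ⟨_, fun _ => rfl⟩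
  obtain ⟨P, hP⟩ : ∃ P : Fin 4 → Fin 4 → ℝ, ∀ i j,
      P i j = τ i * (-2 * a j 0) - τ j * (-2 * a i 0) := ⟨_, fun _ _ => rfl⟩
  have key := d_wedge (obata a) anti jac (fun k => -2 * a k 0) τ hτ D P hD hP
  obtain ⟨e1, e2, e3⟩ := asd_d_obata a jac D hD
  obtain ⟨q1, q2, q3⟩ := asd_p_obata a jac τ hτ P hP
  -- `P = τ ∧ t` is decomposable and anti-self-dual, hence zero
  have pl : P 0 1 * P 2 3 - P 0 2 * P 1 3 + P 0 3 * P 1 2 = 0 := by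
    simp only [hP]; ring
  rw [q1, q2, q3] at pl
  have z1 : P 0 1 = 0 := by nlinarith [sq_nonneg (P 0 1), sq_nonneg (P 0 2), sq_nonneg (P 0 3)]
  have z2 : P 0 2 = 0 := by nlinarith [sq_nonneg (P 0 1), sq_nonneg (P 0 2), sq_nonneg (P 0 3)]
  have z3 : P 0 3 = 0 := by nlinarith [sq_nonneg (P 0 1), sq_nonneg (P 0 2), sq_nonneg (P 0 3)]
  -- hence `D ∧ D = P ∧ D = 0`, and `D ∧ D` is minus the squared length of the anti-self-dual `D`
  rw [q1, q2, q3, z1, z2, z3, e1, e2, e3] at key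
  have y1 : D 0 1 = 0 := by nlinarith [sq_nonneg (D 0 1), sq_nonneg (D 0 2), sq_nonneg (D 0 3)]
  have y2 : D 0 2 = 0 := by nlinarith [sq_nonneg (D 0 1), sq_nonneg (D 0 2), sq_nonneg (D 0 3)]
  have y3 : D 0 3 = 0 := by nlinarith [sq_nonneg (D 0 1), sq_nonneg (D 0 2), sq_nonneg (D 0 3)]
  rw [y1] at e1; rw [y2] at e2; rw [y3] at e3
  have sw (i j) : D i j = -D j i := by
    simp only [hD, anti i j, neg_mul, Finset.sum_neg_distrib]
  have lt : ∀ i j, i < j → D i j = 0 := by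
    intro i j hij
    fin_cases i <;> fin_cases j <;> first | exact absurd hij (by decide) | skip
    all_goals simp [y1, y2, y3, e1, e2, e3]
  rw [← hD]
  rcases lt_trichotomy i j with h | rfl | h
  · exact lt i j h
  · linarith [sw i i]
  · rw [sw, lt j i h, neg_zero]

/-! ### Hyper-Hermitian Lie algebras of dimension four -/

section Algebra

variable {V : Type*} [AddCommGroup V] [Module ℝ V]

/-- A 4-dimensional space with a hyper-Hermitian inner product is isometric to `ℍ` up to a scale
`s`, with the complex structures acting as left multiplications by `i`, `j`, `k`. -/
theorem exists_quat_basis (hV : Module.finrank ℝ V = 4) (J : Fin 3 → V →ₗ[ℝ] V)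
    (sq : ∀ α v, J α (J α v) = -v) (mul : ∀ v, J 0 (J 1 v) = J 2 v)
    (anti : ∀ v, J 1 (J 0 v) = -J 2 v)
    (g : V →ₗ[ℝ] V →ₗ[ℝ] ℝ) (symm : ∀ v w, g v w = g w v) (pos : ∀ v, v ≠ 0 → 0 < g v v)
    (herm : ∀ α v w, g (J α v) (J α w) = g v w) :
    ∃ (b : Module.Basis (Fin 4) ℝ V) (s : ℝ), 0 < s ∧
      (∀ i j, g (b i) (b j) = if i = j then s else 0) ∧
      ∀ α i, J α (b i) = ∑ k, quat α.succ i k • b k := by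
  have : Nontrivial V := Module.nontrivial_of_finrank_pos (R := ℝ) (by omega)
  obtain ⟨v, hv⟩ := exists_ne (0 : V)
  have skew (α v w) : g v (J α w) = -g (J α v) w := by
    rw [← herm α (J α v) w, sq]; simp
  have orth (α w) : g w (J α w) = 0 := by
    have := skew α w w
    rw [symm (J α w)] at this
    linarith
  have orth' (α w) : g (J α w) w = 0 := by rw [symm, orth]
  have m02 (w) : J 0 (J 2 w) = -J 1 w := by rw [← mul, sq]
  have m20 (w) : J 2 (J 0 w) = J 1 w := by rw [← mul, anti, map_neg, m02, neg_neg]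
  have m12 (w) : J 1 (J 2 w) = J 0 w := by
    rw [← neg_eq_iff_eq_neg.mpr (anti w), map_neg, sq, neg_neg]
  have m21 (w) : J 2 (J 1 w) = -J 0 w := by rw [← mul, sq, map_neg]
  set e : Fin 4 → V := ![v, J 0 v, J 1 v, J 2 v] with he
  have ge : ∀ i j, g (e i) (e j) = if i = j then g v v else 0 := by
    have o01 : g (J 0 v) (J 1 v) = 0 := by
      rw [← neg_eq_iff_eq_neg.mpr (skew 0 v (J 1 v)), mul, orth, neg_zero]
    have o02 : g (J 0 v) (J 2 v) = 0 := by
      rw [← neg_eq_iff_eq_neg.mpr (skew 0 v (J 2 v)), m02, map_neg, orth, neg_zero,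
        neg_zero]
    have o12 : g (J 1 v) (J 2 v) = 0 := by
      rw [← neg_eq_iff_eq_neg.mpr (skew 1 v (J 2 v)), m12, orth, neg_zero]
    intro i j
    fin_cases i <;> fin_cases j <;>
      simp [he, herm, orth, orth', o01, o02, o12, symm (J 1 v) (J 0 v), symm (J 2 v) (J 0 v),
        symm (J 2 v) (J 1 v)]
  have li : LinearIndependent ℝ e := by
    rw [Fintype.linearIndependent_iff]
    intro c hc i
    have h : g (∑ j, c j • e j) (e i) = c i * g v v := by
      simp [ge]
    rw [hc] at h
    simpa [(pos v hv).ne'] using h.symm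
  refine ⟨basisOfLinearIndependentOfCardEqFinrank li (by simp [hV]), g v v, pos v hv, ?_, ?_⟩
  · simpa using ge
  · intro α i
    simp only [coe_basisOfLinearIndependentOfCardEqFinrank]
    fin_cases α <;> fin_cases i <;>
      simp [he, quat, quatInt, Fin.sum_univ_four, sq, mul, anti, m02, m20, m12, m21]

theorem eq_zero_of_basis {ι : Type*} (b : Module.Basis ι ℝ V) (T : V → V → V → ℝ)
    (h1 : ∀ v w, IsLinearMap ℝ fun u => T u v w) (h2 : ∀ u w, IsLinearMap ℝ fun v => T u v w)
    (h3 : ∀ u v, IsLinearMap ℝ fun w => T u v w) (h : ∀ i j k, T (b i) (b j) (b k) = 0)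
    (u v w : V) : T u v w = 0 := by
  have e3 (i j w) : T (b i) (b j) w = 0 :=
    LinearMap.congr_fun (b.ext (f₁ := (h3 (b i) (b j)).mk') (f₂ := 0) fun k => h i j k) w
  have e2 (i v w) : T (b i) v w = 0 :=
    LinearMap.congr_fun (b.ext (f₁ := (h2 (b i) w).mk') (f₂ := 0) fun k => e3 i k w) v
  exact LinearMap.congr_fun (b.ext (f₁ := (h1 v w).mk') (f₂ := 0) fun k => e2 k v w) u

/-- A hyper-Hermitian inner product on a 4-dimensional Lie algebra with an integrable hypercomplex
structure has a Lee form `t`, and `t` is closed: it vanishes on brackets. -/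
theorem exists_closed_lee (hV : Module.finrank ℝ V = 4) (J : Fin 3 → V →ₗ[ℝ] V)
    (sq : ∀ α v, J α (J α v) = -v) (mul : ∀ v, J 0 (J 1 v) = J 2 v)
    (anti : ∀ v, J 1 (J 0 v) = -J 2 v)
    (g : V →ₗ[ℝ] V →ₗ[ℝ] ℝ) (symm : ∀ v w, g v w = g w v) (pos : ∀ v, v ≠ 0 → 0 < g v v)
    (herm : ∀ α v w, g (J α v) (J α w) = g v w)
    (B : V →ₗ[ℝ] V →ₗ[ℝ] V) (alt : ∀ v w, B v w = -B w v)
    (jac : ∀ u v w, B u (B v w) + B v (B w u) + B w (B u v) = 0)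
    (nij : ∀ α v w, B (J α v) (J α w) - B v w - J α (B v (J α w) + B (J α v) w) = 0) :
    ∃ t : V →ₗ[ℝ] ℝ, (∀ v w, t (B v w) = 0) ∧ ∀ α u v w,
      -g (B u v) (J α w) + g (B u w) (J α v) - g (B v w) (J α u)
        = t u * g v (J α w) - t v * g u (J α w) + t w * g u (J α v) := by
  obtain ⟨b, s, hs, hg, hJ⟩ := exists_quat_basis hV J sq mul anti g symm pos herm
  obtain ⟨c, hc⟩ : ∃ c : Fin 4 → Fin 4 → Fin 4 → ℝ, ∀ i j k, c i j k = b.repr (B (b i) (b j)) k :=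
    ⟨_, fun _ _ _ => rfl⟩
  have hB (i j) : B (b i) (b j) = ∑ k, c i j k • b k := by
    simp only [hc]; exact (b.sum_repr _).symm
  obtain ⟨a, ha⟩ := exists_eq_obata c (fun i j k => by rw [hc, alt, hc]; simp) (fun α i j m => by
    have h := congrArg (fun x => b.repr x m) (nij α (b i) (b j))
    simp only [hJ, hB, map_sum, map_smul, LinearMap.sum_apply, LinearMap.smul_apply, map_add,
      map_sub, map_zero] at h
    simp [Finsupp.single_apply, Finset.mul_sum, ← mul_assoc] at h
    rw [← h]
    simp only [Finset.sum_add_distrib, Finset.sum_mul, add_mul]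
    congr 1
    · congr 1
      rw [Finset.sum_comm]
      exact Finset.sum_congr rfl fun _ _ => Finset.sum_congr rfl fun _ _ => by ring
    · congr 1
      · rw [Finset.sum_comm]
      · rw [Finset.sum_comm])
  have hja := closed_obata a (fun i j k m => by
    have h := congrArg (fun x => b.repr x m) (jac (b i) (b j) (b k))
    simp only [hB, map_sum, map_smul, map_add, map_zero] at h
    simp [Finsupp.single_apply, Finset.sum_apply', ha, ← Finset.sum_add_distrib] at h
    rw [← h])
  obtain ⟨t, ht⟩ : ∃ t : V →ₗ[ℝ] ℝ, ∀ i, t (b i) = -2 * a i 0 :=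
    ⟨b.constr ℝ fun i => -2 * a i 0, fun i => by simp⟩
  refine ⟨t, fun v w => ?_, fun α u v w => ?_⟩
  · have h1 (i w) : t (B (b i) w) = 0 :=
      LinearMap.congr_fun (b.ext (f₁ := t ∘ₗ B (b i)) (f₂ := 0) fun j => by
        simp only [LinearMap.comp_apply, hB, map_sum, map_smul, ha, ht, smul_eq_mul]
        exact hja i j) w
    exact LinearMap.congr_fun (b.ext (f₁ := t ∘ₗ B.flip w) (f₂ := 0) fun i => h1 i w) v
  · rw [← sub_eq_zero]
    refine eq_zero_of_basis b (fun u v w =>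
      -g (B u v) (J α w) + g (B u w) (J α v) - g (B v w) (J α u)
        - (t u * g v (J α w) - t v * g u (J α w) + t w * g u (J α v))) ?_ ?_ ?_ ?_ u v w
    · intro v w; constructor <;> intros <;> simp <;> ring
    · intro v w; constructor <;> intros <;> simp <;> ring
    · intro v w; constructor <;> intros <;> simp <;> ring
    · intro i j k
      have h := congrArg (s * ·) (lee_obata a α i j k)
      simp only [hJ, hB, ht, ha, map_sum, map_smul, LinearMap.sum_apply, LinearMap.smul_apply, hg,
        smul_eq_mul, mul_ite, mul_zero, Finset.sum_ite_eq, Finset.sum_ite_eq',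
        Finset.mem_univ, if_true]
      simp only [Fin.sum_univ_four] at h ⊢
      linear_combination h

end Algebra

/-! ### Local primitives of closed 1-forms -/

section Primitive

open Set Filter Topology VectorField

variable {E : Type*} [NormedAddCommGroup E] [NormedSpace ℝ E]
  {V : Type*} [NormedAddCommGroup V] [NormedSpace ℝ V]

/-- A 1-form which is constant in a frame `L` with constant structure functions `B`, and which
vanishes on the brackets of the frame, is closed, and so has a primitive on a convex open set. -/
theorem exists_primitive_of_frame [FiniteDimensional ℝ E] [FiniteDimensional ℝ V] {s : Set E}
    (hs : IsOpen s) (hc : Convex ℝ s) (L : E → V →L[ℝ] E) (hL : ContDiffOn ℝ ∞ L s)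
    (inv : ∀ x ∈ s, (L x).IsInvertible) (B : V → V → V)
    (hB : ∀ x ∈ s, ∀ v w, lieBracket ℝ (fun y => L y v) (fun y => L y w) x = L x (B v w))
    (t : V →L[ℝ] ℝ) (ht : ∀ v w, t (B v w) = 0) :
    ∃ f : E → ℝ, ContDiffOn ℝ ∞ f s ∧ ∀ x ∈ s, ∀ v, fderiv ℝ f x (L x v) = t v := by
  have : CompleteSpace V := FiniteDimensional.complete ℝ V
  set A : E → E →L[ℝ] ℝ := fun x => t ∘L (L x).inverse with hA
  have hAs : ContDiffOn ℝ ∞ A s := by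
    intro x hx
    refine contDiffWithinAt_const.clm_comp ?_
    exact (inv x hx).contDiffAt_map_inverse.comp_contDiffWithinAt x (hL x hx)
  have hAL (x) (hx : x ∈ s) (v) : A x (L x v) = t v := by
    simp [hA, (inv x hx).inverse_apply_self]
  have hAd (x) (hx : x ∈ s) : DifferentiableAt ℝ A x :=
    ((hAs x hx).contDiffAt (hs.mem_nhds hx)).differentiableAt (by simp)
  have hLd (x) (hx : x ∈ s) : DifferentiableAt ℝ L x :=
    ((hL x hx).contDiffAt (hs.mem_nhds hx)).differentiableAt (by simp)
  have hLvd (x) (hx : x ∈ s) (v) : DifferentiableAt ℝ (fun y => L y v) x :=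
    (hLd x hx).clm_apply (differentiableAt_const v)
  -- differentiating `A (L v) = t v` in the direction `u`
  have leib (x) (hx : x ∈ s) (v u) :
      fderiv ℝ A x u (L x v) + A x (fderiv ℝ (fun y => L y v) x u) = 0 := by
    have h1 : fderiv ℝ (fun y => A y (L y v)) x = 0 := by
      have : (fun y => A y (L y v)) =ᶠ[𝓝 x] fun _ => t v := by
        filter_upwards [hs.mem_nhds hx] with y hy using hAL y hy v
      rw [this.fderiv_eq]; simp
    rw [fderiv_clm_apply (hAd x hx) (hLvd x hx v)] at h1
    have h2 := DFunLike.congr_fun h1 u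
    simp at h2
    linarith
  obtain ⟨f, hf⟩ := hc.exists_forall_hasFDerivAt_of_fderiv_symmetric hs
    (fun x hx => (hAd x hx).differentiableWithinAt) (fun x hx u u' => by
      obtain ⟨v, rfl⟩ : ∃ v, L x v = u := ⟨_, (inv x hx).self_apply_inverse u⟩
      obtain ⟨w, rfl⟩ : ∃ w, L x w = u' := ⟨_, (inv x hx).self_apply_inverse u'⟩
      have h1 := leib x hx w (L x v)
      have h2 := leib x hx v (L x w)
      have h3 : A x (lieBracket ℝ (fun y => L y v) (fun y => L y w) x) = 0 := by
        rw [hB x hx, hAL x hx, ht]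
      rw [lieBracket, map_sub] at h3
      linarith)
  refine ⟨f, ?_, fun x hx v => by rw [(hf x hx).fderiv, hAL x hx]⟩
  rw [contDiffOn_infty_iff_fderiv_of_isOpen hs]
  exact ⟨fun x hx => (hf x hx).differentiableAt.differentiableWithinAt,
    hAs.congr fun x hx => (hf x hx).fderiv⟩

theorem mlieBracket_modelSpace (X Y : VField (E := E) E) (x : E) :
    mlieBracket 𝓘(ℝ, E) X Y x = lieBracket ℝ X Y x := by
  rw [← mlieBracketWithin_univ, mlieBracketWithin_eq_lieBracketWithin]
  exact congrFun lieBracketWithin_univ x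

variable {M : Type*} [TopologicalSpace M] [ChartedSpace E M] [IsManifold 𝓘(ℝ, E) ∞ M]

/-- The local primitive of `exists_primitive_of_frame`, transported to a manifold by a chart. -/
theorem exists_local_primitive [FiniteDimensional ℝ E] [FiniteDimensional ℝ V]
    (F : ∀ p : M, V →L[ℝ] TangentSpace 𝓘(ℝ, E) p) (inv : ∀ p, (F p).IsInvertible)
    (hF : ∀ v, SmoothVF fun p => F p v) (B : V → V → V)
    (hB : ∀ p v w, bracket (fun q => F q v) (fun q => F q w) p = F p (B v w))
    (t : V →L[ℝ] ℝ) (ht : ∀ v w, t (B v w) = 0) (p : M) :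
    ∃ (U : Set M) (f : M → ℝ), IsOpen U ∧ p ∈ U ∧ ∀ q ∈ U,
      ContMDiffAt 𝓘(ℝ, E) 𝓘(ℝ, ℝ) ∞ f q ∧ ∀ v, differential (E := E) f q (F q v) = t v := by
  set φ := extChartAt 𝓘(ℝ, E) p with hφ
  have hto : IsOpen φ.target := isOpen_extChartAt_target p
  obtain ⟨r, hr, hball⟩ := Metric.isOpen_iff.mp hto (φ p) (mem_extChartAt_target p)
  have : CompleteSpace E := FiniteDimensional.complete ℝ E
  have hle : minSmoothness ℝ 2 ≤ ∞ := by
    rw [minSmoothness_of_isRCLikeNormedField]; exact WithTop.coe_le_coe.2 le_top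
  have : IsManifold 𝓘(ℝ, E) (minSmoothness ℝ 2) M := .of_le hle
  have minv (x) (hx : x ∈ φ.target) :
      (mfderiv 𝓘(ℝ, E) 𝓘(ℝ, E) φ.symm x).IsInvertible := by
    have := isInvertible_mfderivWithin_extChartAt_symm (I := 𝓘(ℝ, E)) (x := p) hx
    rwa [ModelWithCorners.range_eq_univ, mfderivWithin_univ] at this
  have hsm (x) (hx : x ∈ φ.target) : ContMDiffAt 𝓘(ℝ, E) 𝓘(ℝ, E) ∞ φ.symm x :=
    (contMDiffOn_extChartAt_symm p x hx).contMDiffAt (hto.mem_nhds hx)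
  set L : E → V →L[ℝ] E := fun x =>
    (mfderiv 𝓘(ℝ, E) 𝓘(ℝ, E) φ.symm x).inverse ∘L F (φ.symm x) with hL
  have hLv (v) : (fun x => L x v) = mpullback 𝓘(ℝ, E) 𝓘(ℝ, E) φ.symm (fun q => F q v) := rfl
  have hLs : ContDiffOn ℝ ∞ L φ.target := by
    rw [contDiffOn_clm_apply]
    intro v x hx
    have h := ContMDiffAt.mpullback_vectorField_preimage (I := 𝓘(ℝ, E)) (I' := 𝓘(ℝ, E))
      (n := ∞) (m := ∞) (hF v (φ.symm x)) (hsm x hx) (minv x hx) (by simp)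
    rw [← hLv] at h
    have h' := (contMDiff_snd_tangentBundle_modelSpace E 𝓘(ℝ, E) (n := ∞)).contMDiffAt.comp x h
    exact (contMDiffAt_iff_contDiffAt.mp h').contDiffWithinAt
  obtain ⟨f, hf, hft⟩ := exists_primitive_of_frame Metric.isOpen_ball (convex_ball (φ p) r) L
    (hLs.mono hball) (fun x hx => (minv x (hball hx)).inverse.comp (inv _)) B (fun x hx v w => by
      have h := mpullback_mlieBracket (I := 𝓘(ℝ, E)) (I' := 𝓘(ℝ, E)) (n := ∞) (x₀ := x)
        (f := φ.symm) (V := fun q => F q v) (W := fun q => F q w)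
        ((hF v _).mdifferentiableAt (by simp)) ((hF w _).mdifferentiableAt (by simp))
        (hsm x (hball hx)) hle
      refine ((mlieBracket_modelSpace (mpullback 𝓘(ℝ, E) 𝓘(ℝ, E) φ.symm fun q => F q v)
        (mpullback 𝓘(ℝ, E) 𝓘(ℝ, E) φ.symm fun q => F q w) x).symm.trans h.symm).trans ?_
      rw [mpullback_apply]
      exact congrArg _ (hB _ v w)) t ht
  refine ⟨φ.source ∩ φ ⁻¹' Metric.ball (φ p) r, f ∘ φ,
    isOpen_extChartAt_preimage' p Metric.isOpen_ball,
    ⟨mem_extChartAt_source p, by simpa using hr⟩, ?_⟩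
  rintro q ⟨hq, hqb⟩
  obtain ⟨x, hx, rfl⟩ : ∃ x ∈ φ.target, φ.symm x = q := ⟨φ q, φ.map_source hq, φ.left_inv hq⟩
  rw [mem_preimage, φ.right_inv hx] at hqb
  have hfx : ContDiffAt ℝ ∞ f x := (hf x hqb).contDiffAt (Metric.isOpen_ball.mem_nhds hqb)
  have hfx' : ContMDiffAt 𝓘(ℝ, E) 𝓘(ℝ, ℝ) ∞ f (φ (φ.symm x)) := by
    rw [φ.right_inv hx]; exact hfx.contMDiffAt
  have hφs : ContMDiffAt 𝓘(ℝ, E) 𝓘(ℝ, E) ∞ φ (φ.symm x) :=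
    contMDiffAt_extChartAt' (by rwa [← extChartAt_source 𝓘(ℝ, E)])
  refine ⟨hfx'.comp _ hφs, fun v => ?_⟩
  have h1 : mfderiv 𝓘(ℝ, E) 𝓘(ℝ, E) φ (φ.symm x)
      = (mfderiv 𝓘(ℝ, E) 𝓘(ℝ, E) φ.symm x).inverse := by
    have h2 := mfderiv_extChartAt_comp_mfderivWithin_extChartAt_symm (I := 𝓘(ℝ, E)) hx
    have h3 := mfderivWithin_extChartAt_symm_comp_mfderiv_extChartAt (I := 𝓘(ℝ, E)) hx
    rw [ModelWithCorners.range_eq_univ, mfderivWithin_univ] at h2 h3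
    exact (ContinuousLinearMap.inverse_eq h3 h2).symm
  rw [differential, mfderiv_comp _ (hfx'.mdifferentiableAt (by simp))
    (hφs.mdifferentiableAt (by simp)), ← hft x hqb v]
  have h4 : (mfderiv 𝓘(ℝ, E) 𝓘(ℝ, ℝ) f (φ (φ.symm x)) : E →L[ℝ] ℝ) = fderiv ℝ f x := by
    rw [φ.right_inv hx]; exact mfderiv_eq_fderiv
  rw [← h4]
  exact congrArg _ (congrArg (fun T => T (F (φ.symm x) v)) h1)

end Primitive

/-! ### Primitives on simply connected manifolds -/

section GlobalPrimitive

open Set Filter Topology VectorField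

variable {E : Type*} [NormedAddCommGroup E] [NormedSpace ℝ E]
  {V : Type*} [NormedAddCommGroup V] [NormedSpace ℝ V]
  {W : Type*} [NormedAddCommGroup W] [NormedSpace ℝ W]
  {M : Type*} [TopologicalSpace M] [ChartedSpace E M] [IsManifold 𝓘(ℝ, E) ∞ M]

theorem eventually_eq_of_hasMFDerivAt_zero {h : M → W} {x : M}
    (hh : ∀ᶠ y in 𝓝 x, HasMFDerivAt 𝓘(ℝ, E) 𝓘(ℝ, W) h y
      (0 : TangentSpace 𝓘(ℝ, E) y →L[ℝ] TangentSpace 𝓘(ℝ, W) (h y))) :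
    ∀ᶠ y in 𝓝 x, h y = h x := by
  set φ := extChartAt 𝓘(ℝ, E) x with hφ
  have hto : IsOpen φ.target := isOpen_extChartAt_target x
  have hx : φ x ∈ φ.target := mem_extChartAt_target x
  have hc : ContinuousAt φ.symm (φ x) := continuousAt_extChartAt_symm x
  have hxx : φ.symm (φ x) = x := extChartAt_to_inv x
  have h1 : ∀ᶠ z in 𝓝 (φ x), z ∈ φ.target ∧ HasMFDerivAt 𝓘(ℝ, E) 𝓘(ℝ, W) h (φ.symm z)
      (0 : TangentSpace 𝓘(ℝ, E) (φ.symm z) →L[ℝ] TangentSpace 𝓘(ℝ, W) (h (φ.symm z))) :=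
    (hto.eventually_mem hx).and (hc.eventually (by rwa [hxx]))
  obtain ⟨r, hr, hball⟩ := Metric.eventually_nhds_iff_ball.mp h1
  have h2 : ∀ z ∈ Metric.ball (φ x) r, HasFDerivAt (h ∘ φ.symm) (0 : E →L[ℝ] W) z := by
    intro z hz
    obtain ⟨hz1, hz2⟩ := hball z hz
    have h3 : MDifferentiableAt 𝓘(ℝ, E) 𝓘(ℝ, E) φ.symm z :=
      ((contMDiffOn_extChartAt_symm (n := ∞) x z hz1).contMDiffAt
        (hto.mem_nhds hz1)).mdifferentiableAt (by simp)
    have h4 := hz2.comp z h3.hasMFDerivAt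
    rw [ContinuousLinearMap.zero_comp] at h4
    exact hasMFDerivAt_iff_hasFDerivAt.mp h4
  have h5 : ∀ z ∈ Metric.ball (φ x) r, h (φ.symm z) = h x := by
    intro z hz
    have := (convex_ball (φ x) r).is_const_of_fderivWithin_eq_zero (𝕜 := ℝ) (f := h ∘ φ.symm)
      (fun z hz => (h2 z hz).differentiableAt.differentiableWithinAt)
      (fun z hz => by
        rw [fderivWithin_of_isOpen Metric.isOpen_ball hz, (h2 z hz).fderiv])
      hz (Metric.mem_ball_self hr)
    simpa [hxx] using this
  filter_upwards [(continuousAt_extChartAt (I := 𝓘(ℝ, E)) x).preimage_mem_nhds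
      (Metric.ball_mem_nhds _ hr),
    extChartAt_source_mem_nhds (I := 𝓘(ℝ, E)) x] with y hy1 hy2
  rw [← h5 _ hy1, φ.left_inv hy2]

/-- The real numbers with the discrete topology, the typical fibre of a covering space of
primitives. -/
def DiscreteReal : Type := ℝ

instance : TopologicalSpace DiscreteReal := ⊥

instance : DiscreteTopology DiscreteReal := ⟨rfl⟩

/-- The underlying real number. -/
def DiscreteReal.val (u : DiscreteReal) : ℝ := u

/-- Translation by a real number. -/
def DiscreteReal.shift (c : ℝ) (u : DiscreteReal) : DiscreteReal := (u.val + c : ℝ)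

/-- On a simply connected manifold the closed 1-form which is equal to `t` in the frame `F` is
exact. The germs of its local primitives form a covering space of the manifold, with the constants
of integration as fibre, and a global section of it is a primitive. -/
theorem exists_primitive [FiniteDimensional ℝ E] [FiniteDimensional ℝ V] [SimplyConnectedSpace M]
    (F : ∀ p : M, V →L[ℝ] TangentSpace 𝓘(ℝ, E) p) (inv : ∀ p, (F p).IsInvertible)
    (hF : ∀ v, SmoothVF fun p => F p v) (B : V → V → V)
    (hB : ∀ p v w, bracket (fun q => F q v) (fun q => F q w) p = F p (B v w))
    (t : V →L[ℝ] ℝ) (ht : ∀ v w, t (B v w) = 0) :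
    ∃ f : M → ℝ, ContMDiff 𝓘(ℝ, E) 𝓘(ℝ, ℝ) ∞ f ∧
      ∀ p v, differential (E := E) f p (F p v) = t v := by
  choose U f hU hpU hf using exists_local_primitive F inv hF B hB t ht
  have hcon (i j x) (hi : x ∈ U i) (hj : x ∈ U j) :
      ∀ᶠ y in 𝓝 x, f i y - f j y = f i x - f j x := by
    apply eventually_eq_of_hasMFDerivAt_zero (E := E) (h := fun y => f i y - f j y)
    filter_upwards [(hU i).mem_nhds hi, (hU j).mem_nhds hj] with y hyi hyj
    obtain ⟨si, di⟩ := hf i y hyi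
    obtain ⟨sj, dj⟩ := hf j y hyj
    have h1 := (si.mdifferentiableAt (by simp)).hasMFDerivAt.sub
      (sj.mdifferentiableAt (by simp)).hasMFDerivAt
    have h2 : HasMFDerivAt 𝓘(ℝ, E) 𝓘(ℝ, ℝ) (fun y => f i y - f j y) y
      (differential (E := E) (f i) y - differential (E := E) (f j) y) := h1
    have h3 : differential (E := E) (f i) y = differential (E := E) (f j) y := by
      ext u
      obtain ⟨v, rfl⟩ : ∃ v, F y v = u := ⟨_, (inv y).self_apply_inverse u⟩
      rw [di, dj]
    rw [h3, sub_self] at h2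
    exact h2
  -- over `U i` the coordinate `u` stands for the germ of `f i + u`
  let Z : FiberBundleCore M M DiscreteReal :=
    { baseSet := U
      isOpen_baseSet := hU
      indexAt := id
      mem_baseSet_at := hpU
      coordChange := fun i j x u => u.shift (f i x - f j x)
      coordChange_self := fun i x _ v => by
        change (_ + (_ - _) : ℝ) = _
        rw [sub_self, add_zero]
        rfl
      continuousOn_coordChange := by
        rintro i j ⟨x, u⟩ ⟨⟨hi, hj⟩, -⟩
        apply ContinuousAt.continuousWithinAt
        have h1 : ContinuousAt (fun p : M × DiscreteReal => p.2.shift (f i x - f j x)) (x, u) :=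
          (continuous_of_discreteTopology
            (f := DiscreteReal.shift (f i x - f j x))).continuousAt.comp continuousAt_snd
        refine h1.congr ?_
        filter_upwards [continuousAt_fst.eventually (hcon i j x hi hj)] with p hp
        rw [hp]
      coordChange_comp := fun i j k x _ v => by
        change (_ + _ + _ : ℝ) = _ + _
        ring }
  have hcov : IsCoveringMap (π DiscreteReal Z.Fiber) := FiberBundle.isCoveringMap
  have : LocallyPathConnectedSpace M := ChartedSpace.locallyPathConnectedSpace E M
  obtain ⟨x₀⟩ : Nonempty M := inferInstance
  obtain ⟨σ, ⟨-, hσ⟩, -⟩ := hcov.existsUnique_continuousMap_lifts (ContinuousMap.id M) x₀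
    (⟨x₀, (0 : ℝ)⟩ : TotalSpace DiscreteReal Z.Fiber) rfl
  have hσx (x) : (σ x).1 = x := congrFun hσ x
  refine ⟨fun x => DiscreteReal.val (σ x).2 + f x x, ?_⟩
  have key (x) : (fun y => DiscreteReal.val (σ y).2 + f y y) =ᶠ[𝓝 x]
      fun y => DiscreteReal.val (σ x).2 + (f x x - f x x) + f x y := by
    have h1 : ContinuousAt (fun y => (Z.localTriv x (σ y)).2) x := by
      refine continuousAt_snd.comp
        (((Z.localTriv x).continuousAt ?_).comp σ.continuous.continuousAt)
      rw [Z.mem_localTriv_source, hσx]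
      exact hpU x
    have h2 : ∀ᶠ y in 𝓝 x, (Z.localTriv x (σ y)).2 = (Z.localTriv x (σ x)).2 :=
      h1.eventually (p := fun u => u = (Z.localTriv x (σ x)).2) (by simp [nhds_discrete])
    filter_upwards [h2] with y hy
    have h3 (y) : DiscreteReal.val (Z.localTriv x (σ y)).2
        = DiscreteReal.val (σ y).2 + (f y y - f x y) := by
      rw [Z.localTriv_apply]
      change DiscreteReal.val (σ y).2 + (f (σ y).1 (σ y).1 - f x (σ y).1) = _
      rw [hσx]
    have h4 := congrArg DiscreteReal.val hy
    rw [h3, h3] at h4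
    linarith
  refine ⟨fun x => ?_, fun x v => ?_⟩
  · exact (contMDiffAt_const.add (hf x x (hpU x)).1).congr_of_eventuallyEq (key x)
  · rw [differential, (key x).mfderiv_eq]
    have h1 := ((hf x x (hpU x)).1.mdifferentiableAt (by simp)).hasMFDerivAt
    have h2 := ((hasMFDerivAt_const (I := 𝓘(ℝ, E)) (I' := 𝓘(ℝ, ℝ))
      (DiscreteReal.val (σ x).2 + (f x x - f x x)) x).add h1).mfderiv
    refine Eq.trans ?_ ((hf x x (hpU x)).2 v)
    refine (congrArg (fun T => T (F x v)) h2).trans ?_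
    exact congrArg (fun T : TangentSpace 𝓘(ℝ, E) x →L[ℝ] ℝ => T (F x v)) (zero_add _)

end GlobalPrimitive

/-! ### Tensoriality of the exterior derivative -/

section TwoForms

open VectorField

variable {E : Type*} [NormedAddCommGroup E] [NormedSpace ℝ E]
  {M : Type*} [TopologicalSpace M] [ChartedSpace E M]

theorem bracket_swap (X Y : VField (E := E) M) (p : M) : bracket X Y p = -bracket Y X p :=
  mlieBracket_swap_apply

theorem lieD_mul (X : VField (E := E) M) {f g : M → ℝ} {p : M}
    (hf : MDifferentiableAt 𝓘(ℝ, E) 𝓘(ℝ, ℝ) f p) (hg : MDifferentiableAt 𝓘(ℝ, E) 𝓘(ℝ, ℝ) g p) :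
    lieD X (fun q => f q * g q) p = f p * lieD X g p + g p * lieD X f p := by
  have h := (hf.hasMFDerivAt.mul hg.hasMFDerivAt).mfderiv
  exact (congrArg (fun T => T (X p)) h)

theorem lieD_add (X : VField (E := E) M) {f g : M → ℝ} {p : M}
    (hf : MDifferentiableAt 𝓘(ℝ, E) 𝓘(ℝ, ℝ) f p) (hg : MDifferentiableAt 𝓘(ℝ, E) 𝓘(ℝ, ℝ) g p) :
    lieD X (fun q => f q + g q) p = lieD X f p + lieD X g p := by
  have h := (hf.hasMFDerivAt.add hg.hasMFDerivAt).mfderiv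
  exact (congrArg (fun T => T (X p)) h)

theorem lieD_neg (X : VField (E := E) M) (f : M → ℝ) (p : M) :
    lieD X (fun q => - f q) p = -lieD X f p := by
  have h := mfderiv_neg (I := 𝓘(ℝ, E)) (f := f) (x := p)
  exact (congrArg (fun T => T (X p)) h)

theorem lieD_const (X : VField (E := E) M) (c : ℝ) (p : M) : lieD X (fun _ => c) p = 0 := by
  have h := mfderiv_const (I := 𝓘(ℝ, E)) (I' := 𝓘(ℝ, ℝ)) (c := c) (x := p)
  exact (congrArg (fun T => T (X p)) h)

theorem lieD_add_left (X Y : VField (E := E) M) (f : M → ℝ) (p : M) :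
    lieD (X + Y) f p = lieD X f p + lieD Y f p := map_add _ _ _

theorem lieD_smul_left (u : M → ℝ) (X : VField (E := E) M) (f : M → ℝ) (p : M) :
    lieD (u • X) f p = u p * lieD X f p := map_smul _ _ _

variable [IsManifold 𝓘(ℝ, E) ∞ M]

theorem SmoothVF.add {X Y : VField (E := E) M} (hX : SmoothVF X) (hY : SmoothVF Y) :
    SmoothVF (X + Y) := ContMDiff.add_section hX hY

theorem SmoothVF.smul {f : M → ℝ} {X : VField (E := E) M}
    (hf : ContMDiff 𝓘(ℝ, E) 𝓘(ℝ, ℝ) ∞ f) (hX : SmoothVF X) :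
    SmoothVF (f • X) := ContMDiff.smul_section hf hX

theorem SmoothVF.sum {ι : Type*} {s : Finset ι} {X : ι → VField (E := E) M}
    (hX : ∀ i ∈ s, SmoothVF (X i)) : SmoothVF (∑ i ∈ s, X i) := by
  have h := ContMDiff.sum_section (s := s) hX
  simpa only [SmoothVF, Finset.sum_apply] using h

theorem SmoothVF.mdifferentiableAt {X : VField (E := E) M} (hX : SmoothVF X) (p : M) :
    MDifferentiableAt 𝓘(ℝ, E) 𝓘(ℝ, E).tangent
      (fun p => (⟨p, X p⟩ : TangentBundle 𝓘(ℝ, E) M)) p :=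
  ContMDiffAt.mdifferentiableAt (hX p) (by simp)

theorem bracket_add_left [CompleteSpace E] {X X' : VField (E := E) M} (Y : VField (E := E) M)
    (hX : SmoothVF X) (hX' : SmoothVF X') (p : M) :
    bracket (X + X') Y p = bracket X Y p + bracket X' Y p :=
  mlieBracket_add_left (hX.mdifferentiableAt p) (hX'.mdifferentiableAt p)

theorem bracket_smul_left [CompleteSpace E] {f : M → ℝ} {X : VField (E := E) M}
    (Y : VField (E := E) M) (hf : ContMDiff 𝓘(ℝ, E) 𝓘(ℝ, ℝ) ∞ f) (hX : SmoothVF X) (p : M) :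
    bracket (f • X) Y p = f p • bracket X Y p - lieD Y f p • X p := by
  have := mlieBracket_smul_left (I := 𝓘(ℝ, E)) (W := Y)
    ((hf p).mdifferentiableAt (by simp)) (hX.mdifferentiableAt p)
  refine this.trans ?_
  rw [add_comm, neg_smul, ← sub_eq_add_neg]
  rfl

/-- A smooth differential 2-form: a field of alternating bilinear forms whose values on smooth
vector fields are smooth. -/
structure IsTwoForm (σ : TwoTensor (E := E) M) : Prop where
  add_left : ∀ p u v w, σ p (u + v) w = σ p u w + σ p v w
  smul_left : ∀ p (c : ℝ) v w, σ p (c • v) w = c * σ p v w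
  swap : ∀ p v w, σ p v w = -σ p w v
  smooth : ∀ X Y : VField (E := E) M, SmoothVF X → SmoothVF Y →
    ContMDiff 𝓘(ℝ, E) 𝓘(ℝ, ℝ) ∞ fun q => σ q (X q) (Y q)

namespace IsTwoForm

variable {σ : TwoTensor (E := E) M} (hσ : IsTwoForm σ)
include hσ

theorem add_right (p u v w) : σ p u (v + w) = σ p u v + σ p u w := by
  rw [hσ.swap, hσ.add_left, hσ.swap p u v, hσ.swap p u w, neg_add]

theorem smul_right (p) (c : ℝ) (v w) : σ p v (c • w) = c * σ p v w := by
  rw [hσ.swap, hσ.smul_left, hσ.swap p v w, mul_neg]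

theorem neg_left (p v w) : σ p (-v) w = -σ p v w := by
  rw [← neg_one_smul ℝ v, hσ.smul_left, neg_one_mul]

theorem sub_left (p u v w) : σ p (u - v) w = σ p u w - σ p v w := by
  rw [sub_eq_add_neg, hσ.add_left, hσ.neg_left, sub_eq_add_neg]

theorem mdiff {X Y : VField (E := E) M} (hX : SmoothVF X) (hY : SmoothVF Y) (p : M) :
    MDifferentiableAt 𝓘(ℝ, E) 𝓘(ℝ, ℝ) (fun q => σ q (X q) (Y q)) p :=
  (hσ.smooth X Y hX hY p).mdifferentiableAt (by simp)

theorem dTwo_swap_left (X Y Z : VField (E := E) M) (p : M) :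
    dTwo σ X Y Z p = -dTwo σ Y X Z p := by
  have h : (fun q => σ q (X q) (Y q)) = fun q => -σ q (Y q) (X q) := by
    ext q; exact hσ.swap _ _ _
  simp only [dTwo]
  rw [h, lieD_neg, bracket_swap Y X, hσ.neg_left]
  ring

theorem dTwo_swap_right (X Y Z : VField (E := E) M) (p : M) :
    dTwo σ X Y Z p = -dTwo σ X Z Y p := by
  have h : (fun q => σ q (Y q) (Z q)) = fun q => -σ q (Z q) (Y q) := by
    ext q; exact hσ.swap _ _ _
  simp only [dTwo]
  rw [h, lieD_neg, bracket_swap Z Y, hσ.neg_left]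
  ring

theorem dTwo_add [CompleteSpace E] {X X' Y Z : VField (E := E) M} (hX : SmoothVF X)
    (hX' : SmoothVF X') (hY : SmoothVF Y) (hZ : SmoothVF Z) (p : M) :
    dTwo σ (X + X') Y Z p = dTwo σ X Y Z p + dTwo σ X' Y Z p := by
  simp only [dTwo, Pi.add_apply, hσ.add_left, hσ.add_right]
  rw [lieD_add_left, lieD_add _ (hσ.mdiff hX hZ p) (hσ.mdiff hX' hZ p),
    lieD_add _ (hσ.mdiff hX hY p) (hσ.mdiff hX' hY p), bracket_add_left _ hX hX',
    bracket_add_left _ hX hX', hσ.add_left, hσ.add_left]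
  ring

theorem dTwo_smul [CompleteSpace E] {f : M → ℝ} {X Y Z : VField (E := E) M}
    (hf : ContMDiff 𝓘(ℝ, E) 𝓘(ℝ, ℝ) ∞ f) (hX : SmoothVF X)
    (hY : SmoothVF Y) (hZ : SmoothVF Z) (p : M) :
    dTwo σ (f • X) Y Z p = f p * dTwo σ X Y Z p := by
  have hfp := (hf p).mdifferentiableAt (by simp)
  simp only [dTwo, Pi.smul_apply', hσ.smul_left, hσ.smul_right]
  rw [lieD_smul_left, lieD_mul _ hfp (hσ.mdiff hX hZ p),
    lieD_mul _ hfp (hσ.mdiff hX hY p), bracket_smul_left _ hf hX,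
    bracket_smul_left _ hf hX, hσ.sub_left, hσ.sub_left]
  simp only [hσ.smul_left]
  rw [hσ.swap p (X p) (Y p)]
  ring

end IsTwoForm

/-- An alternating function of three vector fields which is tensorial at `p` vanishes if it vanishes
on a global frame. -/
theorem tensorial_eq_zero {ι : Type*} [Fintype ι] {e : ι → VField (E := E) M}
    (he : ∀ i, SmoothVF (e i))
    (hspan : ∀ X : VField (E := E) M, SmoothVF X → ∃ x : ι → M → ℝ,
      (∀ i, ContMDiff 𝓘(ℝ, E) 𝓘(ℝ, ℝ) ∞ (x i)) ∧ X = ∑ i, x i • e i)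
    (T : VField (E := E) M → VField (E := E) M → VField (E := E) M → ℝ)
    (add : ∀ X X' Y Z, SmoothVF X → SmoothVF X' → SmoothVF Y → SmoothVF Z →
      T (X + X') Y Z = T X Y Z + T X' Y Z)
    (p : M) (smul : ∀ f X Y Z, ContMDiff 𝓘(ℝ, E) 𝓘(ℝ, ℝ) ∞ f → SmoothVF X → SmoothVF Y →
      SmoothVF Z → T (f • X) Y Z = f p * T X Y Z)
    (swap_left : ∀ X Y Z, T X Y Z = -T Y X Z) (swap_right : ∀ X Y Z, T X Y Z = -T X Z Y)
    (h : ∀ i j k, T (e i) (e j) (e k) = 0) {X Y Z : VField (E := E) M} (hX : SmoothVF X)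
    (hY : SmoothVF Y) (hZ : SmoothVF Z) : T X Y Z = 0 := by
  have step (X Y Z : VField (E := E) M) (hX : SmoothVF X) (hY : SmoothVF Y) (hZ : SmoothVF Z)
      (h : ∀ i, T (e i) Y Z = 0) : T X Y Z = 0 := by
    classical
    obtain ⟨x, hx, rfl⟩ := hspan X hX
    have : ∀ s : Finset ι, T (∑ i ∈ s, x i • e i) Y Z = 0 := by
      intro s
      induction s using Finset.induction_on with
      | empty =>
        have hz : SmoothVF (0 : VField (E := E) M) := by
          simpa using SmoothVF.sum (s := ∅) (X := e) (by simp)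
        have h0 := add 0 0 Y Z hz hz hY hZ
        rw [add_zero] at h0
        rw [Finset.sum_empty]
        linarith
      | insert i s hi ih =>
        rw [Finset.sum_insert hi, add _ _ _ _ ((he i).smul (hx i))
          (SmoothVF.sum fun j _ => (he j).smul (hx j)) hY hZ, ih, smul _ _ _ _ (hx i) (he i) hY hZ,
          h i, mul_zero, add_zero]
    exact this _
  refine step X Y Z hX hY hZ fun i => ?_
  rw [swap_left, neg_eq_zero]
  refine step Y _ Z hY (he i) hZ fun j => ?_
  rw [swap_left, neg_eq_zero, swap_right, neg_eq_zero, swap_left, neg_eq_zero]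
  refine step Z _ _ hZ (he i) (he j) fun k => ?_
  exact h k i j

section Metric

variable (H : Hypercomplex E M) (g : Metric E M)

theorem SmoothVF.J {X : VField (E := E) M} (hX : SmoothVF X) (α : Fin 3) :
    SmoothVF fun q => H.J α q (X q) :=
  ContMDiff.clm_bundle_apply (b := fun q : M => q) (H.smooth α) hX

theorem contMDiff_inner {X Y : VField (E := E) M} (hX : SmoothVF X) (hY : SmoothVF Y) :
    ContMDiff 𝓘(ℝ, E) 𝓘(ℝ, ℝ) ∞ fun q => g.inner q (X q) (Y q) := by
  intro p
  have h : ContMDiffAt 𝓘(ℝ, E) (𝓘(ℝ, E).prod 𝓘(ℝ, ℝ)) ∞ (fun q : M =>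
      TotalSpace.mk' ℝ (E := Bundle.Trivial M ℝ) q (g.inner q (X q) (Y q))) p :=
    ContMDiffAt.clm_bundle_apply₂ (F₁ := E) (F₂ := E) (g.contMDiff p) (hX p) (hY p)
  rw [contMDiffAt_totalSpace] at h
  exact h.2

variable {H g}

theorem IsHyperHermitian.inner_J_left (hg : IsHyperHermitian H g) (α : Fin 3) (p : M)
    (v w : TangentSpace 𝓘(ℝ, E) p) : g.inner p (H.J α p v) w = -g.inner p v (H.J α p w) := by
  rw [← hg α p v (H.J α p w), H.sq, map_neg, neg_neg]

theorem IsHyperHermitian.isTwoForm (hg : IsHyperHermitian H g) (α : Fin 3) :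
    IsTwoForm (fundForm H g α) where
  add_left p u v w := by simp [fundForm]
  smul_left p c v w := by simp [fundForm]
  swap p v w := by
    simp only [fundForm]
    rw [← hg.inner_J_left, g.symm]
  smooth X Y hX hY := contMDiff_inner g hX (hY.J H α)

end Metric

end TwoForms

/-! ### Conformal change in an invariant frame -/

section Frame

open VectorField

variable {E : Type*} [NormedAddCommGroup E] [NormedSpace ℝ E]
  {M : Type*} [TopologicalSpace M] [ChartedSpace E M]

theorem differential_exp_neg {f : M → ℝ} {p : M} (hf : MDifferentiableAt 𝓘(ℝ, E) 𝓘(ℝ, ℝ) f p)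
    (v : TangentSpace 𝓘(ℝ, E) p) :
    differential (E := E) (fun q => Real.exp (-f q)) p v
      = -(Real.exp (-f p) * differential (E := E) f p v) := by
  have h1 : HasMFDerivAt 𝓘(ℝ, ℝ) 𝓘(ℝ, ℝ) (fun x => Real.exp (-x)) (f p) _ :=
    ((Real.hasDerivAt_exp (-f p)).comp (f p) (hasDerivAt_neg (f p))).hasFDerivAt.hasMFDerivAt
  have h2 := (h1.comp p hf.hasMFDerivAt).mfderiv
  refine (congrArg (fun T => T v) h2).trans ?_
  change (differential (E := E) f p v) • (Real.exp (-f p) * -1) = _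
  rw [smul_eq_mul]
  ring

variable [IsManifold 𝓘(ℝ, E) ∞ M] {H : Hypercomplex E M} {g : Metric E M}

/-- The conformally changed metric `e^{-f} g`. -/
def conformal (g : Metric E M) (f : M → ℝ) (hf : ContMDiff 𝓘(ℝ, E) 𝓘(ℝ, ℝ) ∞ f) : Metric E M where
  inner p := Real.exp (-f p) • g.inner p
  symm p v w := by simp [g.symm p v w]
  pos p v hv := by
    simpa using mul_pos (Real.exp_pos _) (g.pos p v hv)
  -- scaling by `e^{f/2}` maps the unit ball of `g` onto the unit ball of `e^{-f} g`
  isVonNBounded p := by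
    have h := (g.isVonNBounded p).image
      (Real.exp (f p / 2) • ContinuousLinearMap.id ℝ (TangentSpace 𝓘(ℝ, E) p))
    refine h.subset fun v hv => (Set.mem_image _ _ _).mpr ⟨Real.exp (-(f p / 2)) • v, ?_, ?_⟩
    · simp only [Set.mem_ofPred_eq, smul_apply, smul_eq_mul, map_smul] at hv ⊢
      rwa [← mul_assoc, ← Real.exp_add, show -(f p / 2) + -(f p / 2) = -f p by ring]
    · simp [smul_smul, ← Real.exp_add]
  contMDiff := by
    have h : ContMDiff 𝓘(ℝ, E) 𝓘(ℝ, ℝ) ∞ fun p => Real.exp (-f p) :=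
      Real.contDiff_exp.contMDiff.comp hf.neg
    exact ContMDiff.smul_section h g.contMDiff

theorem inner_conformal (f : M → ℝ) (hf : ContMDiff 𝓘(ℝ, E) 𝓘(ℝ, ℝ) ∞ f) (p : M)
    (v w : TangentSpace 𝓘(ℝ, E) p) :
    (conformal g f hf).inner p v w = Real.exp (-f p) * g.inner p v w := rfl

theorem dTwo_mul {σ : TwoTensor (E := E) M} (hσ : IsTwoForm σ) {u : M → ℝ}
    (hu : ContMDiff 𝓘(ℝ, E) 𝓘(ℝ, ℝ) ∞ u) {X Y Z : VField (E := E) M} (hX : SmoothVF X)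
    (hY : SmoothVF Y) (hZ : SmoothVF Z) (p : M) :
    dTwo (fun q v w => u q * σ q v w) X Y Z p
      = u p * dTwo σ X Y Z p + wedge (differential u) σ p (X p) (Y p) (Z p) := by
  have hup := (hu p).mdifferentiableAt (by simp)
  simp only [dTwo, wedge]
  rw [lieD_mul _ hup (hσ.mdiff hY hZ p), lieD_mul _ hup (hσ.mdiff hX hZ p),
    lieD_mul _ hup (hσ.mdiff hX hY p)]
  simp only [lieD]
  ring

/-- If `dω = df ∧ ω` then `d (e^{-f} ω) = 0`. -/
theorem isHyperKahler_conformal (hg : IsHyperHermitian H g) {f : M → ℝ}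
    (hf : ContMDiff 𝓘(ℝ, E) 𝓘(ℝ, ℝ) ∞ f) (hlee : HasLeeForm H g (differential f)) :
    IsHyperKahler H (conformal g f hf) := by
  refine ⟨fun α p v w => by rw [inner_conformal, inner_conformal, hg], ?_⟩
  intro α X Y Z hX hY hZ p
  have h : ContMDiff 𝓘(ℝ, E) 𝓘(ℝ, ℝ) ∞ fun p => Real.exp (-f p) :=
    Real.contDiff_exp.contMDiff.comp hf.neg
  refine (dTwo_mul (hg.isTwoForm α) h hX hY hZ p).trans ?_
  rw [hlee α X Y Z hX hY hZ]
  simp only [wedge, differential_exp_neg ((hf p).mdifferentiableAt (by simp))]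
  ring

variable {V : Type*} [NormedAddCommGroup V] [NormedSpace ℝ V]

/-- The conclusion for a hyper-Hermitian metric which is constant, together with the complex
structures and the brackets, in a global frame `F`. The value at a point of the frame then inherits
the structure of a Lie algebra, to which `exists_closed_lee` applies. -/
theorem exists_hyperKahler_of_frame [FiniteDimensional ℝ E] [SimplyConnectedSpace M]
    (hg : IsHyperHermitian H g) (hV : Module.finrank ℝ V = 4)
    (F : ∀ p : M, V →L[ℝ] TangentSpace 𝓘(ℝ, E) p) (inv : ∀ p, (F p).IsInvertible)
    (hF : ∀ v, SmoothVF fun p => F p v)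
    (J : Fin 3 → V →L[ℝ] V) (hJ : ∀ α p v, H.J α p (F p v) = F p (J α v))
    (g₀ : V →L[ℝ] V →L[ℝ] ℝ) (hg₀ : ∀ p v w, g.inner p (F p v) (F p w) = g₀ v w)
    (B : V → V → V) (hB : ∀ p v w, bracket (fun q => F q v) (fun q => F q w) p = F p (B v w)) :
    ∃ (h : Metric E M) (f : M → ℝ), IsHyperKahler H h ∧ ContMDiff 𝓘(ℝ, E) 𝓘(ℝ, ℝ) ∞ f ∧
      (∀ (p : M) (v w : TangentSpace 𝓘(ℝ, E) p),
        g.inner p v w = Real.exp (f p) * h.inner p v w) ∧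
      HasLeeForm H g (differential f) := by
  have : FiniteDimensional ℝ V := Module.finite_of_finrank_pos (by omega)
  have : CompleteSpace E := FiniteDimensional.complete ℝ E
  have hle2 : minSmoothness ℝ 2 ≤ ∞ := by
    rw [minSmoothness_of_isRCLikeNormedField]; exact WithTop.coe_le_coe.2 le_top
  have hle3 : minSmoothness ℝ 3 ≤ ∞ := by
    rw [minSmoothness_of_isRCLikeNormedField]; exact WithTop.coe_le_coe.2 le_top
  have : IsManifold 𝓘(ℝ, E) (minSmoothness ℝ 3) M := .of_le hle3
  obtain ⟨p₀⟩ : Nonempty M := inferInstance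
  have inj (p) : Function.Injective (F p) := (inv p).injective
  have hadd (v w) : (fun q => F q (v + w)) = (fun q => F q v) + fun q => F q w := by
    ext q; exact map_add _ _ _
  have hsmul (c : ℝ) (v) : (fun q => F q (c • v)) =
      (fun _ : M => c) • fun q => F q v := by
    ext q; exact map_smul _ _ _
  have hfun (v w) : bracket (fun q => F q v) (fun q => F q w) = fun q => F q (B v w) :=
    funext fun q => hB q v w
  -- the structure functions `B` of the frame are bilinear and alternating because brackets are
  have Balt (v w) : B v w = -B w v := by
    apply inj p₀; rw [map_neg, ← hB, ← hB, bracket_swap]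
  have Badd (v v' w) : B (v + v') w = B v w + B v' w := by
    apply inj p₀
    rw [map_add, ← hB, ← hB, ← hB, hadd, bracket_add_left _ (hF v) (hF v')]
  have Bsmul (c : ℝ) (v w) : B (c • v) w = c • B v w := by
    apply inj p₀
    rw [map_smul, ← hB, ← hB, hsmul, bracket_smul_left _ contMDiff_const (hF v), lieD_const,
      zero_smul, sub_zero]
  let Bl : V →ₗ[ℝ] V →ₗ[ℝ] V := LinearMap.mk₂ ℝ B Badd Bsmul
    (fun v w w' => by rw [Balt, Badd, Balt w, Balt w']; abel)
    (fun c v w => by rw [Balt, Bsmul, Balt w, smul_neg, neg_neg])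
  let gl : V →ₗ[ℝ] V →ₗ[ℝ] ℝ := LinearMap.mk₂ ℝ (fun v w => g₀ v w) (by simp) (by simp) (by simp)
    (by simp)
  have hsq (α v) : J α (J α v) = -v := inj p₀ (by rw [← hJ, ← hJ, H.sq, map_neg])
  have hmul (v) : J 0 (J 1 v) = J 2 v := inj p₀ (by rw [← hJ, ← hJ, H.mul, hJ])
  have hanti (v) : J 1 (J 0 v) = -J 2 v := inj p₀ (by rw [← hJ, ← hJ, H.anti, hJ, map_neg])
  have hsymm (v w) : g₀ v w = g₀ w v := by rw [← hg₀ p₀, g.symm, hg₀]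
  have hpos (v) (hv : v ≠ 0) : 0 < g₀ v v := by
    rw [← hg₀ p₀]
    exact g.pos _ _ fun h => hv (inj p₀ (by rw [h, map_zero]))
  have hherm (α v w) : g₀ (J α v) (J α w) = g₀ v w := by
    rw [← hg₀ p₀, ← hJ, ← hJ, hg, hg₀]
  obtain ⟨t, htB, htL⟩ := exists_closed_lee hV (fun α => (J α : V →ₗ[ℝ] V)) hsq hmul hanti gl
    hsymm hpos hherm Bl Balt
    (fun u v w => by
      change B u (B v w) + B v (B w u) + B w (B u v) = 0
      have h : B u (B v w) = B (B u v) w + B v (B u w) := by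
        apply inj p₀
        have h := leibniz_identity_mlieBracket_apply (I := 𝓘(ℝ, E)) (x := p₀)
          (((hF u) p₀).of_le hle2) (((hF v) p₀).of_le hle2) (((hF w) p₀).of_le hle2)
        rw [map_add, ← hB, ← hB, ← hB, ← hfun, ← hfun, ← hfun]
        exact h
      have h' : B v (B u w) = -B v (B w u) := by
        rw [Balt u w]; exact map_neg (Bl v) _
      rw [h, h', Balt (B u v) w]
      abel)
    (fun α v w => by
      change B (J α v) (J α w) - B v w - J α (B v (J α w) + B (J α v) w) = 0
      have h := H.nijenhuis α _ _ (hF v) (hF w) p₀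
      simp only [hJ, hfun] at h
      apply inj p₀
      rw [map_zero, ← h, map_sub, map_sub, ← hJ, map_add])
  obtain ⟨f, hf, hft⟩ := exists_primitive F inv hF B hB (LinearMap.toContinuousLinearMap t) htB
  obtain ⟨b, s, hs, hbg, -⟩ := exists_quat_basis hV (fun α => (J α : V →ₗ[ℝ] V)) hsq hmul hanti gl
    hsymm hpos hherm
  have hlee : HasLeeForm H g (differential f) := by
    intro α X Y Z hX hY hZ p
    rw [← sub_eq_zero]
    refine tensorial_eq_zero (e := fun i q => F q (b i)) (fun i => hF _) ?_
      (fun X Y Z => dTwo (fundForm H g α) X Y Z p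
        - wedge (differential f) (fundForm H g α) p (X p) (Y p) (Z p)) ?_ p ?_ ?_ ?_ ?_ hX hY hZ
    · -- the coordinates of `X` in an orthogonal frame are smooth
      intro X hX
      refine ⟨fun i q => s⁻¹ * g.inner q (X q) (F q (b i)), fun i =>
        contMDiff_const.mul (contMDiff_inner g hX (hF _)), ?_⟩
      ext q
      obtain ⟨v, hv⟩ : ∃ v, F q v = X q := ⟨_, (inv q).self_apply_inverse (X q)⟩
      have hvi (i) : g₀ v (b i) = b.repr v i * s := by
        have hbg' (j) : g₀ (b j) (b i) = if j = i then s else 0 := hbg j i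
        calc g₀ v (b i) = g₀ (∑ j, b.repr v j • b j) (b i) := by rw [b.sum_repr]
          _ = b.repr v i * s := by
            simp only [map_sum, map_smul, sum_apply, smul_apply,
              hbg', smul_eq_mul, mul_ite, mul_zero, Finset.sum_ite_eq', Finset.mem_univ, if_true]
      rw [Finset.sum_apply, ← hv]
      conv_lhs => rw [← b.sum_repr v, map_sum]
      refine Finset.sum_congr rfl fun i _ => ?_
      change F q (b.repr v i • b i) = (s⁻¹ * g.inner q (X q) (F q (b i))) • F q (b i)
      rw [← hv, hg₀, hvi, map_smul, mul_comm _ s, inv_mul_cancel_left₀ hs.ne']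
    · intro X X' Y Z hX hX' hY hZ
      have hσ := hg.isTwoForm α
      simp only [hσ.dTwo_add hX hX' hY hZ, wedge, Pi.add_apply, hσ.add_left, map_add]
      ring
    · intro u X Y Z hu hX hY hZ
      have hσ := hg.isTwoForm α
      simp only [hσ.dTwo_smul hu hX hY hZ, wedge, Pi.smul_apply', hσ.smul_left, map_smul,
        smul_eq_mul]
      ring
    · intro X Y Z
      have hσ := hg.isTwoForm α
      rw [hσ.dTwo_swap_left]
      simp only [wedge]
      rw [hσ.swap p (X p) (Y p)]
      ring
    · intro X Y Z
      have hσ := hg.isTwoForm α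
      rw [hσ.dTwo_swap_right]
      simp only [wedge]
      rw [hσ.swap p (Y p) (Z p)]
      ring
    · intro i j k
      have h : -g₀ (B (b i) (b j)) (J α (b k)) + g₀ (B (b i) (b k)) (J α (b j))
          - g₀ (B (b j) (b k)) (J α (b i)) = t (b i) * g₀ (b j) (J α (b k))
          - t (b j) * g₀ (b i) (J α (b k)) + t (b k) * g₀ (b i) (J α (b j)) :=
        htL α (b i) (b j) (b k)
      have hc (q v w) : fundForm H g α q (F q v) (F q w) = g₀ v (J α w) := by
        simp only [fundForm, hJ, hg₀]
      have hft' (v) : differential (E := E) f p (F p v) = t v := hft p v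
      simp only [dTwo, hc, lieD_const, hB, wedge, hft']
      linear_combination h
  refine ⟨conformal g f hf, f, isHyperKahler_conformal hg hf hlee, hf, fun p v w => ?_, hlee⟩
  rw [inner_conformal, ← mul_assoc, ← Real.exp_add, add_neg_cancel, Real.exp_zero, one_mul]

end Frame

/-! ### The orbit map of a simply transitive action -/

section Orbit

open Set Filter Topology

variable {E : Type*} [NormedAddCommGroup E] [NormedSpace ℝ E]
  {M : Type*} [TopologicalSpace M] [ChartedSpace E M]
  {F : Type*} [NormedAddCommGroup F] [NormedSpace ℝ F]

/-- A smooth homeomorphism with invertible differentials has a smooth inverse. -/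
theorem contMDiff_symm_of_isInvertible {N : Type*} [TopologicalSpace N] [ChartedSpace F N]
    [IsManifold 𝓘(ℝ, F) ∞ N] [CompleteSpace F] (e : N ≃ₜ M)
    (he : ContMDiff 𝓘(ℝ, F) 𝓘(ℝ, E) ∞ e)
    (inv : ∀ a, (mfderiv 𝓘(ℝ, F) 𝓘(ℝ, E) e a).IsInvertible) :
    ContMDiff 𝓘(ℝ, E) 𝓘(ℝ, F) ∞ e.symm := by
  intro p
  obtain ⟨a, rfl⟩ := e.surjective p
  refine contMDiffAt_iff.mpr ⟨e.symm.continuous.continuousAt, ?_⟩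
  have hd := ((he a).mdifferentiableAt (by simp)).hasMFDerivAt
  have hs := (contMDiffAt_iff.mp (he a)).2
  obtain ⟨T, hT⟩ := inv a
  -- `k` is `e` read in charts
  let k : OpenPartialHomeomorph F E :=
    ((chartAt F a).symm.trans e.toOpenPartialHomeomorph).trans (chartAt E (e a))
  have hka : k.symm (chartAt E (e a) (e a)) = chartAt F a a := by
    change chartAt F a (e.symm ((chartAt E (e a)).symm (chartAt E (e a) (e a)))) = _
    rw [(chartAt E (e a)).left_inv (mem_chart_source E (e a)), e.symm_apply_apply]
  have hmem : chartAt E (e a) (e a) ∈ k.target := by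
    have h : chartAt F a a ∈ k.source := by
      simp [k, mem_chart_source]
    have := k.map_source h
    convert this using 1
    change _ = chartAt E (e a) (e ((chartAt F a).symm (chartAt F a a)))
    rw [(chartAt F a).left_inv (mem_chart_source F a)]
  have h1 : HasFDerivAt k ((show F ≃L[ℝ] E from T) : F →L[ℝ] E)
      (k.symm (chartAt E (e a) (e a))) := by
    rw [hka]
    have h2 := hd.2
    rw [← hT] at h2
    rw [ModelWithCorners.range_eq_univ] at h2
    exact hasFDerivWithinAt_univ.mp h2
  have h3 : ContDiffAt ℝ ∞ k (k.symm (chartAt E (e a) (e a))) := by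
    rw [hka]
    rw [ModelWithCorners.range_eq_univ] at hs
    exact contDiffWithinAt_univ.mp hs
  have h4 := (k.contDiffAt_symm hmem h1 h3).contDiffWithinAt (s := range 𝓘(ℝ, E))
  rw [e.symm_apply_apply]
  exact h4

theorem isInvertible_mfderiv_smul {G : Type*} [Group G] [MulAction G M] (a : G) (q : M)
    (h : ∀ b : G, ContMDiff 𝓘(ℝ, E) 𝓘(ℝ, E) ∞ fun q : M => b • q) :
    (mfderiv 𝓘(ℝ, E) 𝓘(ℝ, E) (fun q : M => a • q) q).IsInvertible := by
  let Φ : M ≃ₘ^∞⟮𝓘(ℝ, E), 𝓘(ℝ, E)⟯ M :=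
    { toEquiv := MulAction.toPerm a
      contMDiff_toFun := h a
      contMDiff_invFun := h a⁻¹ }
  exact ⟨Φ.mfderivToContinuousLinearEquiv (by simp) q, rfl⟩

variable {G : Type*} [TopologicalSpace G] [ChartedSpace F G] [Group G] [MulAction G M]
  [ContMDiffSMul 𝓘(ℝ, F) 𝓘(ℝ, E) ∞ G M]

variable (G) in
theorem contMDiff_orbit (p : M) : ContMDiff 𝓘(ℝ, F) 𝓘(ℝ, E) ∞ fun a : G => a • p :=
  (ContMDiffSMul.contMDiff_smul (I := 𝓘(ℝ, F)) (I' := 𝓘(ℝ, E)) (n := ∞) (G := G) (M := M)).comp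
    (contMDiff_id.prodMk contMDiff_const)

variable [LieGroup 𝓘(ℝ, F) ∞ G]

/-- The derivative of `(a * b) • p = a • b • p` in `b`. The base point `c = a * b` is a separate
variable so that the tangent vector on the left can be taken at `a` when `b = 1`. -/
theorem mfderiv_orbit_mul {p : M} {a c b : G} (hc : c = a * b) (k : TangentSpace 𝓘(ℝ, F) b) :
    mfderiv 𝓘(ℝ, F) 𝓘(ℝ, E) (fun b : G => b • p) c
        (mfderiv 𝓘(ℝ, F) 𝓘(ℝ, F) (fun b : G => a * b) b k)
      = mfderiv 𝓘(ℝ, E) 𝓘(ℝ, E) (fun q : M => a • q) (b • p)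
        (mfderiv 𝓘(ℝ, F) 𝓘(ℝ, E) (fun b : G => b • p) b k) := by
  subst hc
  have h1 : MDifferentiable 𝓘(ℝ, F) 𝓘(ℝ, E) fun b : G => b • p :=
    (contMDiff_orbit G p).mdifferentiable (by simp)
  have h2 : MDifferentiable 𝓘(ℝ, F) 𝓘(ℝ, F) fun b : G => a * b :=
    (contMDiff_mul_left (I := 𝓘(ℝ, F)) (n := ∞)).mdifferentiable (by simp)
  have h3 : MDifferentiable 𝓘(ℝ, E) 𝓘(ℝ, E) fun q : M => a • q :=
    (ContMDiffSMul.contMDiff_const_smul (I := 𝓘(ℝ, F)) (n := ∞) a).mdifferentiable (by simp)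
  have e1 := mfderiv_comp b (h1 (a * b)) (h2 b)
  have e2 := mfderiv_comp b (h3 (b • p)) (h1 b)
  have e3 : (fun b : G => b • p) ∘ (fun b : G => a * b)
      = (fun q : M => a • q) ∘ fun b : G => b • p := by
    ext b; exact mul_smul a b p
  exact (congrArg (fun T => T k) e1).symm.trans
    ((congrArg (fun f : G → M => (mfderiv 𝓘(ℝ, F) 𝓘(ℝ, E) f b k : E)) e3).trans
      (congrArg (fun T => T k) e2))

variable [FiniteDimensional ℝ F]

/-- The differential at `1` of an injective orbit map is injective: a vector in its kernel
generates a one-parameter group fixing the base point. -/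
theorem mfderiv_orbit_injective [IsManifold 𝓘(ℝ, E) ∞ M] [T2Space G] {p : M}
    (hp : Function.Injective fun a : G => a • p) :
    Function.Injective (mfderiv 𝓘(ℝ, F) 𝓘(ℝ, E) (fun a : G => a • p) 1) := by
  have hle3 : minSmoothness ℝ 3 ≤ ∞ := by
    rw [minSmoothness_of_isRCLikeNormedField]; exact WithTop.coe_le_coe.2 le_top
  have : LieGroup 𝓘(ℝ, F) (minSmoothness ℝ 3) G := .of_le hle3
  have : CompleteSpace F := FiniteDimensional.complete ℝ F
  rw [injective_iff_map_eq_zero]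
  intro k hk
  have hX := contMDiff_mulInvariantVectorField (I := 𝓘(ℝ, F)) (G := G) k
  have : IsManifold 𝓘(ℝ, F) 1 G := .of_le (n := ∞) (WithTop.coe_le_coe.2 le_top)
  -- `γ` is an integral curve of the left-invariant field `X` with `X 1 = k`; the differential of
  -- the orbit map kills `X`, so the orbit map is constant along `γ`, and by injectivity `γ` is
  -- constant
  obtain ⟨γ, hγ0, hγ⟩ := exists_isMIntegralCurveAt_of_contMDiffAt_boundaryless (I := 𝓘(ℝ, F)) 0
    ((hX 1).of_le (m := 1) (by
      rw [minSmoothness_of_isRCLikeNormedField]; exact one_le_two))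
  set φ := extChartAt 𝓘(ℝ, E) p with hφ
  have hπ : MDifferentiable 𝓘(ℝ, F) 𝓘(ℝ, E) fun b : G => b • p :=
    (contMDiff_orbit G p).mdifferentiable (by simp)
  have hγc : ContinuousAt γ 0 := hγ.self_of_nhds.continuousAt
  have hsrc : ∀ᶠ t in 𝓝 (0 : ℝ), γ t • p ∈ φ.source := by
    have h1 : ContinuousAt (fun t => γ t • p) 0 :=
      ((contMDiff_orbit (E := E) (F := F) G p).continuous.continuousAt).comp hγc
    refine h1.eventually ?_
    change ∀ᶠ y in 𝓝 (γ 0 • p), y ∈ φ.source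
    rw [hγ0, one_smul]
    exact extChartAt_source_mem_nhds p
  have hd : ∀ᶠ t in 𝓝 (0 : ℝ), HasMFDerivAt 𝓘(ℝ, ℝ) 𝓘(ℝ, E) (fun t => φ (γ t • p)) t
      (0 : TangentSpace 𝓘(ℝ, ℝ) t →L[ℝ] TangentSpace 𝓘(ℝ, E) (φ (γ t • p))) := by
    filter_upwards [hγ, hsrc] with t ht hst
    have h1 := (hπ (γ t)).hasMFDerivAt.comp t ht
    have h2 : MDifferentiableAt 𝓘(ℝ, E) 𝓘(ℝ, E) φ (γ t • p) :=
      mdifferentiableAt_extChartAt (by rwa [hφ, extChartAt_source] at hst)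
    have h3 := h2.hasMFDerivAt.comp t h1
    have h4 : mfderiv 𝓘(ℝ, F) 𝓘(ℝ, E) (fun b : G => b • p) (γ t)
        (mulInvariantVectorField k (γ t)) = 0 := by
      refine (mfderiv_orbit_mul (mul_one _).symm k).trans ?_
      rw [hk]
      exact map_zero _
    have h5 (r : ℝ) : (mfderiv 𝓘(ℝ, F) 𝓘(ℝ, E) (fun b : G => b • p) (γ t) : F →L[ℝ] E)
        (r • (mulInvariantVectorField k (γ t) : F)) = 0 :=
      (map_smul _ r _).trans ((congrArg (fun x : E => r • x) h4).trans
        (smul_zero (M := ℝ) (A := E) r))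
    exact h3.congr_mfderiv (ContinuousLinearMap.ext fun r =>
      (congrArg (mfderiv 𝓘(ℝ, E) 𝓘(ℝ, E) φ (γ t • p)) (h5 r)).trans (map_zero _))
  have hconst := eventually_eq_of_hasMFDerivAt_zero hd
  have hγ1 : ∀ᶠ t in 𝓝 (0 : ℝ), γ t = 1 := by
    filter_upwards [hconst, hsrc] with t ht hst
    apply hp
    have h0 := hsrc.self_of_nhds
    change γ t • p = (1 : G) • p
    rw [← hγ0]
    exact φ.injOn hst h0 ht
  have h5 : HasMFDerivAt 𝓘(ℝ, ℝ) 𝓘(ℝ, F) γ 0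
      (0 : TangentSpace 𝓘(ℝ, ℝ) (0 : ℝ) →L[ℝ] TangentSpace 𝓘(ℝ, F) (γ 0)) :=
    (hasMFDerivAt_const (1 : G) (0 : ℝ)).congr_of_eventuallyEq hγ1
  have h6 := hasMFDerivAt_unique hγ.self_of_nhds h5
  have h7 : mulInvariantVectorField (I := 𝓘(ℝ, F)) k (γ 0) = 0 :=
    (one_smul ℝ _).symm.trans (congrArg (fun T : ℝ →L[ℝ] F => T 1) h6)
  rw [hγ0] at h7
  have h8 : (fun b : G => 1 * b) = id := by ext; simp
  have h9 : mulInvariantVectorField (I := 𝓘(ℝ, F)) k 1 = k := by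
    refine (congrArg (fun f : G → G => (mfderiv 𝓘(ℝ, F) 𝓘(ℝ, F) f 1 k : F)) h8).trans ?_
    rw [mfderiv_id]
    rfl
  rw [← h9, h7]

variable [FiniteDimensional ℝ E]

theorem isInvertible_of_injective {T : F →L[ℝ] E} (hT : Function.Injective T)
    (h : Module.finrank ℝ F = Module.finrank ℝ E) : T.IsInvertible :=
  ⟨(LinearEquiv.ofInjectiveOfFinrankEq T.toLinearMap hT h).toContinuousLinearEquiv, rfl⟩

/-- A smooth open map does not raise the dimension: a chart image of it has nonempty interior, and
smooth maps do not raise the Hausdorff dimension. -/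
theorem finrank_le_of_isOpenMap {N : Type*} [TopologicalSpace N] [ChartedSpace F N]
    [IsManifold 𝓘(ℝ, F) ∞ N] {f : N → M} (hf : ContMDiff 𝓘(ℝ, F) 𝓘(ℝ, E) ∞ f)
    (ho : IsOpenMap f) (a : N) : Module.finrank ℝ E ≤ Module.finrank ℝ F := by
  have hs := (contMDiffAt_iff.mp (hf a)).2
  rw [ModelWithCorners.range_eq_univ] at hs
  set k := extChartAt 𝓘(ℝ, E) (f a) ∘ f ∘ (extChartAt 𝓘(ℝ, F) a).symm with hk
  obtain ⟨u, hu, hau, hku⟩ := hs.contDiffOn' (m := 1) (WithTop.coe_le_coe.2 le_top) (by simp)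
  obtain ⟨r, hr, hball⟩ := Metric.mem_nhds_iff.mp (hu.mem_nhds hau)
  rw [insert_eq_of_mem (mem_univ _), univ_inter] at hku
  have himg : k '' Metric.ball (extChartAt 𝓘(ℝ, F) a a) r ∈ 𝓝 (extChartAt 𝓘(ℝ, E) (f a) (f a)) := by
    rw [hk, image_comp, image_comp]
    apply extChartAt_image_nhds_mem_nhds_of_boundaryless
    apply ho.image_mem_nhds
    have h := Filter.image_mem_map (m := (extChartAt 𝓘(ℝ, F) a).symm)
      (Metric.ball_mem_nhds (extChartAt 𝓘(ℝ, F) a a) hr)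
    have h' := map_extChartAt_symm_nhdsWithin_range (I := 𝓘(ℝ, F)) a
    rw [ModelWithCorners.range_eq_univ, nhdsWithin_univ] at h'
    rwa [h'] at h
  have h1 := (hku.mono hball).dimH_image_le (convex_ball _ r) subset_rfl
  rw [Real.dimH_of_mem_nhds himg, Real.dimH_of_mem_nhds (Metric.ball_mem_nhds _ hr)] at h1
  exact_mod_cast h1

/-- The orbit map of a simply transitive action is a diffeomorphism. It is a homeomorphism by the
open mapping theorem for group actions on Baire spaces; being open, it forces the dimensions to
agree, so that its injective differentials are invertible. -/
theorem exists_contMDiff_orbit_section [IsManifold 𝓘(ℝ, E) ∞ M] [T2Space M] [T2Space G]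
    [SecondCountableTopology G] (h : IsSimplyTransitive G M) (p : M) :
    ∃ s : M → G, ContMDiff 𝓘(ℝ, E) 𝓘(ℝ, F) ∞ s ∧ ∀ q, s q • p = q := by
  have : CompleteSpace F := FiniteDimensional.complete ℝ F
  have : IsTopologicalGroup G := topologicalGroup_of_lieGroup 𝓘(ℝ, F) ∞
  have : ContinuousSMul G M := ContMDiffSMul.continuousSMul (I := 𝓘(ℝ, F)) (I' := 𝓘(ℝ, E)) ∞
  have : LocallyCompactSpace G := Manifold.locallyCompact_of_finiteDimensional 𝓘(ℝ, F)
  have : LocallyCompactSpace M := Manifold.locallyCompact_of_finiteDimensional 𝓘(ℝ, E)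
  have : MulAction.IsPretransitive G M := ⟨fun p q => (h p q).exists⟩
  have ho : IsOpenMap fun a : G => a • p := isOpenMap_smul_of_sigmaCompact p
  have hinj : Function.Injective fun a : G => a • p :=
    fun a b hab => (h p (b • p)).unique hab rfl
  let e : G ≃ₜ M := (Equiv.ofBijective (fun a : G => a • p)
    ⟨hinj, fun q => (h p q).exists⟩).toHomeomorphOfContinuousOpen
      (continuous_id.smul continuous_const) ho
  have he : ContMDiff 𝓘(ℝ, F) 𝓘(ℝ, E) ∞ e := contMDiff_orbit G p
  have h1 := mfderiv_orbit_injective (E := E) (F := F) hinj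
  have hdim : Module.finrank ℝ F = Module.finrank ℝ E :=
    le_antisymm (LinearMap.finrank_le_finrank_of_injective
      (f := (mfderiv 𝓘(ℝ, F) 𝓘(ℝ, E) (fun a : G => a • p) 1 : F →L[ℝ] E).toLinearMap) h1)
      (finrank_le_of_isOpenMap he ho 1)
  have hinv (a : G) : (mfderiv 𝓘(ℝ, F) 𝓘(ℝ, E) e a).IsInvertible := by
    have ha : Function.Injective (mfderiv 𝓘(ℝ, F) 𝓘(ℝ, E) e a : F →L[ℝ] E) := by
      rw [injective_iff_map_eq_zero]
      intro k hk
      have h2 := mfderiv_orbit_mul (E := E) (p := p) (a := a⁻¹) (b := a) (c := 1) (by simp) k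
      have h3 := (isInvertible_mfderiv_smul (E := F) a⁻¹ a fun b : G =>
        contMDiff_mul_left (I := 𝓘(ℝ, F)) (n := ∞) (a := b)).injective
      have h4 : mfderiv 𝓘(ℝ, F) 𝓘(ℝ, E) (fun b : G => b • p) a k = 0 := hk
      rw [h4] at h2
      have h5 := h1 ((h2.trans (map_zero _)).trans (map_zero _).symm)
      exact h3 (h5.trans (map_zero _).symm)
    exact isInvertible_of_injective (E := E) (F := F)
      (T := mfderiv 𝓘(ℝ, F) 𝓘(ℝ, E) e a) ha hdim
  exact ⟨e.symm, contMDiff_symm_of_isInvertible e he hinv, e.apply_symm_apply⟩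

end Orbit

/-! ### The invariant frame -/

section InvariantFrame

open VectorField

variable {E : Type*} [NormedAddCommGroup E] [NormedSpace ℝ E]
  {M : Type*} [TopologicalSpace M] [ChartedSpace E M]
  {G : Type*} [Group G] [MulAction G M]

/-- The frame obtained by translating the tangent space at `p₀` (identified with the model space
`E`) to each point `p` by the group element `s p`; it is meant for `s p • p₀ = p`. -/
def translate (s : M → G) (p₀ p : M) : E →L[ℝ] TangentSpace 𝓘(ℝ, E) p :=
  (mfderiv 𝓘(ℝ, E) 𝓘(ℝ, E) (fun q : M => s p • q) p₀ :
    TangentSpace 𝓘(ℝ, E) p₀ →L[ℝ] TangentSpace 𝓘(ℝ, E) (s p • p₀))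

/-- To prove a property of the frame at `p = s p • p₀`, it is enough to prove it for the
differential of `s p` at `p₀`, whose values are tangent vectors at `s p • p₀`. -/
theorem translate_induction {s : M → G} {p₀ p : M} (hsp : s p • p₀ = p)
    (P : ∀ q : M, (E →L[ℝ] TangentSpace 𝓘(ℝ, E) q) → Prop)
    (hP : P (s p • p₀) (mfderiv 𝓘(ℝ, E) 𝓘(ℝ, E) (fun q : M => s p • q) p₀)) :
    P p (translate s p₀ p) := by
  have key : ∀ q, s p • p₀ = q →
      P q (mfderiv 𝓘(ℝ, E) 𝓘(ℝ, E) (fun q : M => s p • q) p₀ : E →L[ℝ] E) := by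
    rintro _ rfl; exact hP
  exact key p hsp

/-- The translated frame is invariant under the group. -/
theorem mfderiv_smul_translate (h : ∀ b : G, ContMDiff 𝓘(ℝ, E) 𝓘(ℝ, E) ∞ fun q : M => b • q)
    {s : M → G} {p₀ : M} (a : G) (p : M) (hs : s (a • p) = a * s p) (hsp : s p • p₀ = p) (v : E) :
    mfderiv 𝓘(ℝ, E) 𝓘(ℝ, E) (fun q : M => a • q) p (translate s p₀ p v)
      = translate s p₀ (a • p) v := by
  refine translate_induction hsp
    (fun q T => mfderiv 𝓘(ℝ, E) 𝓘(ℝ, E) (fun q : M => a • q) q (T v) =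
      (translate s p₀ (a • p) v : E)) ?_
  have h1 := mfderiv_comp p₀ ((h a).mdifferentiable (by simp) _)
    ((h (s p)).mdifferentiable (by simp) p₀)
  have h2 : (fun q : M => a • q) ∘ (fun q : M => s p • q) = fun q : M => s (a • p) • q := by
    ext q; rw [hs]; exact (mul_smul a (s p) q).symm
  exact (congrArg (fun T : E →L[ℝ] E => T v) h1).symm.trans
    (congrArg (fun f : M → M => (mfderiv 𝓘(ℝ, E) 𝓘(ℝ, E) f p₀ v : E)) h2)

variable [IsManifold 𝓘(ℝ, E) ∞ M]

/-- Brackets of invariant vector fields are invariant. -/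
theorem mfderiv_smul_bracket [CompleteSpace E]
    (h : ∀ b : G, ContMDiff 𝓘(ℝ, E) 𝓘(ℝ, E) ∞ fun q : M => b • q)
    {X Y : VField (E := E) M} (hX : SmoothVF X) (hY : SmoothVF Y) (a : G)
    (hXa : ∀ p, mfderiv 𝓘(ℝ, E) 𝓘(ℝ, E) (fun q : M => a • q) p (X p) = X (a • p))
    (hYa : ∀ p, mfderiv 𝓘(ℝ, E) 𝓘(ℝ, E) (fun q : M => a • q) p (Y p) = Y (a • p)) (p : M) :
    mfderiv 𝓘(ℝ, E) 𝓘(ℝ, E) (fun q : M => a • q) p (bracket X Y p) = bracket X Y (a • p) := by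
  have hle2 : minSmoothness ℝ 2 ≤ ∞ := by
    rw [minSmoothness_of_isRCLikeNormedField]; exact WithTop.coe_le_coe.2 le_top
  have : IsManifold 𝓘(ℝ, E) (minSmoothness ℝ 2) M := .of_le hle2
  have inv (p) := isInvertible_mfderiv_smul (E := E) a p h
  have hpull {X : VField (E := E) M}
      (hXa : ∀ p, mfderiv 𝓘(ℝ, E) 𝓘(ℝ, E) (fun q : M => a • q) p (X p) = X (a • p)) :
      mpullback 𝓘(ℝ, E) 𝓘(ℝ, E) (fun q : M => a • q) X = X := by
    ext p
    rw [mpullback_apply, (inv p).inverse_apply_eq]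
    exact (hXa p).symm
  have hb := mpullback_mlieBracket (I := 𝓘(ℝ, E)) (I' := 𝓘(ℝ, E)) (f := fun q : M => a • q)
    (x₀ := p) ((hX _).mdifferentiableAt (by simp)) ((hY _).mdifferentiableAt (by simp)) (h a p) hle2
  rw [hpull hXa, hpull hYa, mpullback_apply, (inv p).inverse_apply_eq] at hb
  exact hb.symm

variable {F : Type*} [NormedAddCommGroup F] [NormedSpace ℝ F] [TopologicalSpace G]
  [ChartedSpace F G] [LieGroup 𝓘(ℝ, F) ∞ G] [ContMDiffSMul 𝓘(ℝ, F) 𝓘(ℝ, E) ∞ G M]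

/-- The translated frame is smooth, being the image of a smooth section under the tangent map of the
action `G × M → M`. -/
theorem smoothVF_translate {s : M → G} (hs : ContMDiff 𝓘(ℝ, E) 𝓘(ℝ, F) ∞ s) {p₀ : M}
    (hsp : ∀ p, s p • p₀ = p) (v : E) : SmoothVF fun p => translate s p₀ p v := by
  have hact : ContMDiff (𝓘(ℝ, F).prod 𝓘(ℝ, E)) 𝓘(ℝ, E) ∞ fun x : G × M => x.1 • x.2 :=
    ContMDiffSMul.contMDiff_smul
  let fs : M → TangentBundle 𝓘(ℝ, F) G := fun p => TotalSpace.mk' F (s p) 0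
  have hfs : ContMDiff 𝓘(ℝ, E) 𝓘(ℝ, F).tangent ∞ fs :=
    (contMDiff_zeroSection ℝ _).comp hs
  let fv : M → TangentBundle 𝓘(ℝ, E) M := fun _ => TotalSpace.mk' E p₀ v
  have hfv : ContMDiff 𝓘(ℝ, E) 𝓘(ℝ, E).tangent ∞ fv := contMDiff_const
  have S₂ : ContMDiff _ _ ∞ (equivTangentBundleProd 𝓘(ℝ, F) G 𝓘(ℝ, E) M).symm :=
    contMDiff_equivTangentBundleProd_symm
  have S₃ := hact.contMDiff_tangentMap (m := ∞) le_rfl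
  have S := (S₃.comp S₂).comp (hfs.prodMk hfv)
  have key : ∀ p q, s p • p₀ = q → (TotalSpace.mk' E q
      (mfderiv 𝓘(ℝ, E) 𝓘(ℝ, E) (fun q : M => s p • q) p₀ v : E) : TangentBundle 𝓘(ℝ, E) M)
      = TotalSpace.mk' E (s p • p₀) (mfderiv 𝓘(ℝ, E) 𝓘(ℝ, E) (fun q : M => s p • q) p₀ v) := by
    rintro p q rfl; rfl
  refine S.congr fun p => (key p p (hsp p)).trans ?_
  have hd := mfderiv_prod_eq_add_apply (p := (s p, p₀)) (v := ((0 : F), (v : E)))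
    (hact.mdifferentiable (by simp) (s p, p₀))
  refine (congrArg (fun w : E => (TotalSpace.mk' E (s p • p₀) w : TangentBundle 𝓘(ℝ, E) M))
    (hd.trans ?_)).symm
  exact (congrArg (fun x : E => x + _) (map_zero _)).trans (zero_add _)

end InvariantFrame

end HyperHerm

end

theorem theorem1p1
    {M : Type*} [TopologicalSpace M] [T2Space M] [SecondCountableTopology M]
    [ChartedSpace (EuclideanSpace ℝ (Fin 4)) M]
    [IsManifold 𝓘(ℝ, EuclideanSpace ℝ (Fin 4)) ∞ M]
    [SimplyConnectedSpace M]
    (H : HyperHerm.Hypercomplex (EuclideanSpace ℝ (Fin 4)) M)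
    (g : HyperHerm.Metric (EuclideanSpace ℝ (Fin 4)) M)
    (hg : HyperHerm.IsHyperHermitian H g)
    {F : Type*} [NormedAddCommGroup F] [NormedSpace ℝ F] [FiniteDimensional ℝ F]
    {G : Type*} [TopologicalSpace G] [T2Space G] [SecondCountableTopology G]
    [ChartedSpace F G] [Group G] [LieGroup 𝓘(ℝ, F) ∞ G]
    [MulAction G M]
    [ContMDiffSMul 𝓘(ℝ, F) 𝓘(ℝ, EuclideanSpace ℝ (Fin 4)) ∞ G M]
    (htrans : HyperHerm.IsSimplyTransitive G M)
    (hact : ∀ a : G,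
      ∃ φ : M ≃ₘ^∞⟮𝓘(ℝ, EuclideanSpace ℝ (Fin 4)), 𝓘(ℝ, EuclideanSpace ℝ (Fin 4))⟯ M,
        (∀ p, φ p = a • p) ∧ HyperHerm.IsIsometric g φ ∧ HyperHerm.IsHypercomplexMap H φ) :
    ∃ (h : HyperHerm.Metric (EuclideanSpace ℝ (Fin 4)) M) (f : M → ℝ),
      HyperHerm.IsHyperKahler H h ∧
      ContMDiff 𝓘(ℝ, EuclideanSpace ℝ (Fin 4)) 𝓘(ℝ, ℝ) ∞ f ∧
      (∀ (p : M) (v w : TangentSpace 𝓘(ℝ, EuclideanSpace ℝ (Fin 4)) p),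
        g.inner p v w = Real.exp (f p) * h.inner p v w) ∧
      HyperHerm.HasLeeForm H g (HyperHerm.differential f) := by
  open HyperHerm in
  obtain ⟨p₀⟩ : Nonempty M := inferInstance
  set E := EuclideanSpace ℝ (Fin 4) with hE
  have hc (b : G) : ContMDiff 𝓘(ℝ, E) 𝓘(ℝ, E) ∞ fun q : M => b • q :=
    ContMDiffSMul.contMDiff_const_smul (I := 𝓘(ℝ, F)) b
  obtain ⟨s, hs, hsp⟩ := exists_contMDiff_orbit_section (E := E) (F := F) htrans p₀
  have hsmul (a : G) (p : M) : s (a • p) = a * s p :=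
    (htrans p₀ (a • p)).unique (hsp _) (by rw [mul_smul, hsp])
  have hF := smoothVF_translate hs hsp
  have htr (a : G) (v : E) (p : M) := mfderiv_smul_translate hc a p (hsmul a p) (hsp p) v
  have hJg (a : G) : (∀ (p : M) (v w : TangentSpace 𝓘(ℝ, E) p),
      g.inner (a • p) (mfderiv 𝓘(ℝ, E) 𝓘(ℝ, E) (fun q : M => a • q) p v)
        (mfderiv 𝓘(ℝ, E) 𝓘(ℝ, E) (fun q : M => a • q) p w) = g.inner p v w) ∧
      ∀ (α : Fin 3) (p : M) (v : TangentSpace 𝓘(ℝ, E) p),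
        mfderiv 𝓘(ℝ, E) 𝓘(ℝ, E) (fun q : M => a • q) p (H.J α p v)
          = H.J α (a • p) (mfderiv 𝓘(ℝ, E) 𝓘(ℝ, E) (fun q : M => a • q) p v) := by
    obtain ⟨φ, hφ, hi, hh⟩ := hact a
    have hφ' : ⇑φ = fun q : M => a • q := funext hφ
    unfold IsIsometric at hi
    unfold IsHypercomplexMap at hh
    rw [hφ'] at hi hh
    exact ⟨hi, hh⟩
  let J : Fin 3 → E →L[ℝ] E := fun α => H.J α p₀
  let g₀ : E →L[ℝ] E →L[ℝ] ℝ := g.inner p₀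
  refine exists_hyperKahler_of_frame hg (V := E) finrank_euclideanSpace_fin (translate s p₀) ?_ hF
    J ?_ g₀ ?_
    (fun v w => bracket (fun q => translate s p₀ q v) (fun q => translate s p₀ q w) p₀) ?_
  · exact fun p => translate_induction (E := E) (hsp p) (fun q T => T.IsInvertible)
      (isInvertible_mfderiv_smul (s p) p₀ hc)
  · exact fun α p v => translate_induction (E := E) (hsp p)
      (fun q T => H.J α q (T v) = T (H.J α p₀ v)) ((hJg (s p)).2 α p₀ v).symm
  · exact fun p v w => translate_induction (E := E) (hsp p)
      (fun q T => g.inner q (T v) (T w) = g.inner p₀ v w) ((hJg (s p)).1 p₀ v w)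
  · exact fun p v w => translate_induction (E := E) (hsp p)
      (fun q T => bracket (fun q => translate s p₀ q v) (fun q => translate s p₀ q w) q
        = T (bracket (fun q => translate s p₀ q v) (fun q => translate s p₀ q w) p₀))
      (mfderiv_smul_bracket hc (hF v) (hF w) (s p) (htr (s p) v) (htr (s p) w) p₀).symm
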